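/- Notation. An anisotropy is a norm $\varphi$ on $\mathbb R^2$; $\varphi^\circ(x)=\sup\{\xi\cdot x:\varphi(\xi)\le 1\}$ is its polar norm, and $\varphi$ is elliptic if $\varphi^2$ is strongly convex. A closed curve $u:\mathbb R/2\pi\mathbb Z\to\mathbb R^2$ (possibly with self-intersections) that is locally an injectively traversed Lipschitz graph has an arc-length parameter $s\in\mathbb R/L\mathbb Z$ ($L$ being its length), a unit tangent $\tau=u_s$ and a unit normal $\nu=\tau^\perp$, the rotation of $\tau$ by $+\pi/2$, for a.e. $s$. Such a curve is $\varphi$-regular if it admits a Cahn–Hoffman field, i.e. an $L$-periodic Lipschitz field $n=n(s)$ with $n(s)\in\partial\varphi^\circ(\nu(s))$ for a.e. $s$. Its anisotropic curvature is $\kappa_\varphi=-N_s\cdot\tau$ (a.e.), where $N$ is a Cahn–Hoffman field minimizing $\int_0^L (n_s\cdot\tau)^2\varphi^\circ(\nu)\,ds$ among all Cahn–Hoffman fields. Statement. Let $\varphi$ be an anisotropy and let $u$ be a $\varphi$-regular closed curve with $|\kappa_\varphi|\le C$ a.e. Let $(\varphi_\varepsilon)_{\varepsilon>0}$ be elliptic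 anisotropies of class $C^\infty(\mathbb R^2\setminus\{0\})$ with $\varphi_\varepsilon\ge\varphi$ and $\varphi_\varepsilon\to\varphi$ uniformly on compact sets as $\varepsilon\to0^+$. Then for every $C'>C$ there exist $C^\infty$ immersed closed curves $u_\varepsilon:\mathbb R/2\pi\mathbb Z\to\mathbb R^2$, $\varepsilon>0$, such that each $u_\varepsilon$ is $\varphi_\varepsilon$-regular with $|\kappa_{\varphi_\varepsilon}|\le C'$, and $u_\varepsilon\to u$ uniformly as $\varepsilon\to0^+$. -/

import Mathlib

open Set Filter Topology MeasureTheory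
open scoped ContDiff

noncomputable section

/-- The Euclidean plane. -/
abbrev Plane := EuclideanSpace ℝ (Fin 2)

/-- Anticlockwise rotation by a right angle, `(a, b) ↦ (-b, a)`. -/
def perp (v : Plane) : Plane := !₂[-v 1, v 0]

/-- An anisotropy is a norm on the plane. (Nonnegativity follows from these three laws.) -/
structure IsAnisotropy (φ : Plane → ℝ) : Prop where
  add_le : ∀ x y, φ (x + y) ≤ φ x + φ y
  smul : ∀ (a : ℝ) (x : Plane), φ (a • x) = |a| * φ x
  eq_zero : ∀ x, φ x = 0 → x = 0

/-- Ellipticity: `φ²` is strongly convex, i.e. `D²(φ²) ≥ m Id` in the sense of distributions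
for some `m > 0`. -/
def IsElliptic (φ : Plane → ℝ) : Prop :=
  ∃ m : ℝ, 0 < m ∧ StrongConvexOn univ m (fun x => φ x ^ 2)

/-- The polar norm `φ°(x) = sup {ξ · x | φ(ξ) ≤ 1}`. -/
def polar (φ : Plane → ℝ) (x : Plane) : ℝ :=
  sSup {r : ℝ | ∃ ξ : Plane, φ ξ ≤ 1 ∧ r = inner ℝ ξ x}

/-- The subdifferential of `ψ` at `x`. -/
def subdifferential (ψ : Plane → ℝ) (x : Plane) : Set Plane :=
  {p | ∀ y, ψ x + inner ℝ p (y - x) ≤ ψ y}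

/-- A closed curve is a function `u` on `ℝ` of period `2π`. It is locally a Lipschitz graph
if every parameter has a neighbourhood on which `u` runs injectively along the graph of a
Lipschitz function, in some orthonormal frame `e, perp e`. Other branches of an immersed curve
may pass through the same point of the plane. -/
def IsLocallyLipschitzGraph (u : ℝ → Plane) : Prop :=
  ∀ x₀ : ℝ, ∃ (δ : ℝ) (e : Plane) (f : ℝ → ℝ) (K : NNReal),
    0 < δ ∧ ‖e‖ = 1 ∧ LipschitzWith K f ∧
    InjOn (fun x => inner ℝ (u x) e) (Ioo (x₀ - δ) (x₀ + δ)) ∧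
    ∀ x ∈ Ioo (x₀ - δ) (x₀ + δ), inner ℝ (u x) (perp e) = f (inner ℝ (u x) e)

/-- `γ`, of period `L`, is the arc-length parametrization of the closed curve `u`
(of period `2π`), and `L` is the length: `u = γ ∘ σ` where `σ x` is the arc-length parameter
of the point with parameter `x`. -/
structure IsArcLengthParam (u γ : ℝ → Plane) (L : ℝ) : Prop where
  pos : 0 < L
  periodic : Function.Periodic γ L
  lipschitz : LipschitzWith 1 γ
  unit_speed : ∀ᵐ s : ℝ, ‖deriv γ s‖ = 1
  reparam : ∃ σ : ℝ → ℝ, Continuous σ ∧ StrictMono σ ∧ σ 0 = 0 ∧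
    (∀ x, σ (x + 2 * Real.pi) = σ x + L) ∧ ∀ x, u x = γ (σ x)

/-- The unit tangent of an arc-length parametrized curve. -/
def tangent (γ : ℝ → Plane) (s : ℝ) : Plane := deriv γ s

/-- The unit normal, which is the tangent rotated by a right angle. -/
def normal (γ : ℝ → Plane) (s : ℝ) : Plane := perp (tangent γ s)

/-- `n` is a Cahn-Hoffman vector field along the closed curve with arc-length parametrization
`γ` and length `L`. -/
structure IsCahnHoffman (φ : Plane → ℝ) (γ : ℝ → Plane) (L : ℝ) (n : ℝ → Plane) : Prop where
  periodic : Function.Periodic n L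
  lipschitz : ∃ K : NNReal, LipschitzWith K n
  mem : ∀ᵐ s : ℝ, n s ∈ subdifferential (polar φ) (normal γ s)

/-- The energy `∫₀ᴸ (n_s · τ)² φ°(ν) ds`. -/
def cahnHoffmanEnergy (φ : Plane → ℝ) (γ : ℝ → Plane) (L : ℝ) (n : ℝ → Plane) : ℝ :=
  ∫ s in (0 : ℝ)..L, (inner ℝ (deriv n s) (tangent γ s)) ^ 2 * polar φ (normal γ s)

/-- A Cahn-Hoffman vector field of least energy. -/
def IsMinimalCahnHoffman (φ : Plane → ℝ) (γ : ℝ → Plane) (L : ℝ) (N : ℝ → Plane) : Prop :=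
  IsCahnHoffman φ γ L N ∧
    ∀ n, IsCahnHoffman φ γ L n → cahnHoffmanEnergy φ γ L N ≤ cahnHoffmanEnergy φ γ L n

/-- `φ`-regularity of a closed curve. -/
def IsPhiRegular (φ : Plane → ℝ) (u : ℝ → Plane) : Prop :=
  IsLocallyLipschitzGraph u ∧
    ∃ (γ : ℝ → Plane) (L : ℝ), IsArcLengthParam u γ L ∧ ∃ n, IsCahnHoffman φ γ L n

/-- `κ` is the scalar anisotropic curvature of `u` as a function of arc length:
`κ = - N_s · τ` a.e., where `N` is a Cahn-Hoffman vector field of least energy. -/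
def IsAnisotropicCurvature (φ : Plane → ℝ) (u : ℝ → Plane) (κ : ℝ → ℝ) : Prop :=
  ∃ (γ : ℝ → Plane) (L : ℝ) (N : ℝ → Plane), IsArcLengthParam u γ L ∧
    IsMinimalCahnHoffman φ γ L N ∧ ∀ᵐ s : ℝ, κ s = -inner ℝ (deriv N s) (tangent γ s)

end

/-! The least-energy field $N$ runs along the sphere $\{\varphi=1\}$ with Euclidean speed
$|\kappa_\varphi|$ a.e.: for fixed $s$, $N(x)\cdot\nu(s)$ is maximal at $x=s$, so $N_s$ has no
normal component. Conversely, let $\varphi'$ be smooth and elliptic and let $p$ parametrize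
$\{\varphi'=1\}$ anticlockwise by arc length. A function $l$ prescribes a tangent field $T=-p'(l)$,
and a closed curve with velocity $\rho T$, $\rho>0$, has $p\circ l$ as its only Cahn–Hoffman field
and curvature at most $|l'|/\rho$. So it suffices to find $l$ with $|l'|$ hardly above $C$ and $T$
close to $\tau$ in $L^1$; integration turns this into uniform closeness of the curves.

As $\varphi'\ge\varphi$, the path $N$ avoids the open $\varphi'$-ball, and the nearest-point
projection, being 1-Lipschitz, carries it to $\{\varphi'=1\}$ without lengthening it. When $N(s)$
sits at a corner of $\{\varphi=1\}$, the normal at the projected point may be far from $\nu(s)$.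
Projecting $N+t\nu$ instead cures this once $\varphi'$ is close to $\varphi$ in terms of $t$. As
$\nu$ is merely measurable, only the points of a grid of mesh $h$ are pushed out, with $t$ a small
multiple of $h$. Arcs of length at most $(1+\kappa)(Ch+2t)$ join consecutive projected points
(`exists_transition`), and by convexity the tangents along such an arc are controlled by those at
its ends (`norm_deriv_sub_le`). On a suitable grid $\tau$ is nearly a step function in the mean
(`exists_grid`), and interpolation and mollification give $l$ (`exists_angle`).

The field $T$ need not have mean zero. The tangents of a closed curve with a Cahn–Hoffman field are
not confined to a line (`integral_inner_sq_pos`), so $\int T\otimes T$ is positive definite and a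
weight $\rho=1+a\cdot T$ with small $a$ closes the curve (`exists_weight`, `exists_closed_curve`).
The slack $C'-C$ pays for the pushes and for $\rho\ne1$. -/

/-! ### Coordinates and rotated frames in the plane. -/

lemma Plane.inner_eq (x y : Plane) : inner ℝ x y = x 0 * y 0 + x 1 * y 1 := by
  simp [PiLp.inner_apply, Fin.sum_univ_two, mul_comm]

lemma Plane.norm_sq_eq (x : Plane) : ‖x‖ ^ 2 = x 0 ^ 2 + x 1 ^ 2 := by
  rw [EuclideanSpace.norm_sq_eq]; simp [Fin.sum_univ_two]

lemma Plane.ext_coords {x y : Plane} (h0 : x 0 = y 0) (h1 : x 1 = y 1) : x = y := by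
  ext i; fin_cases i <;> assumption

@[simp] lemma perp_zero_coord (v : Plane) : perp v 0 = -v 1 := rfl
@[simp] lemma perp_one_coord (v : Plane) : perp v 1 = v 0 := rfl

lemma perp_smul (c : ℝ) (v : Plane) : perp (c • v) = c • perp v := by
  apply Plane.ext_coords <;> simp

lemma perp_add (v w : Plane) : perp (v + w) = perp v + perp w := by
  apply Plane.ext_coords <;> simp [add_comm]

lemma perp_neg (v : Plane) : perp (-v) = -perp v := by
  apply Plane.ext_coords <;> simp

lemma perp_sub (v w : Plane) : perp (v - w) = perp v - perp w := by
  rw [sub_eq_add_neg, perp_add, perp_neg, ← sub_eq_add_neg]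

lemma perp_perp (v : Plane) : perp (perp v) = -v := by
  apply Plane.ext_coords <;> simp

lemma norm_perp (v : Plane) : ‖perp v‖ = ‖v‖ := by
  have := Plane.norm_sq_eq (perp v)
  have h2 := Plane.norm_sq_eq v
  simp at this
  have h3 : ‖perp v‖ ^ 2 = ‖v‖ ^ 2 := by rw [this, h2]; ring
  exact (sq_eq_sq₀ (norm_nonneg _) (norm_nonneg _)).1 h3

lemma inner_perp_perp (v w : Plane) : inner ℝ (perp v) (perp w) = inner ℝ v w := by
  simp [Plane.inner_eq]; ring

lemma inner_perp_self (v : Plane) : inner ℝ (perp v) v = 0 := by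
  simp [Plane.inner_eq]; ring

lemma inner_perp_left (v w : Plane) : inner ℝ (perp v) w = -inner ℝ v (perp w) := by
  simp [Plane.inner_eq]

/-- Expansion in the orthonormal frame `v, perp v`. -/
lemma eq_frame {v : Plane} (hv : ‖v‖ = 1) (w : Plane) :
    w = (inner ℝ w v : ℝ) • v + (inner ℝ w (perp v) : ℝ) • perp v := by
  have h := Plane.norm_sq_eq v
  rw [hv] at h
  apply Plane.ext_coords <;> simp [Plane.inner_eq] <;> linear_combination (w _) * h

lemma norm_sq_frame {v : Plane} (hv : ‖v‖ = 1) (w : Plane) :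
    ‖w‖ ^ 2 = (inner ℝ w v : ℝ) ^ 2 + (inner ℝ w (perp v) : ℝ) ^ 2 := by
  have h := Plane.norm_sq_eq v
  rw [hv] at h
  rw [Plane.norm_sq_eq]
  simp only [Plane.inner_eq, perp_zero_coord, perp_one_coord]
  linear_combination (w 0 ^ 2 + w 1 ^ 2) * h

/-! ### Norms, polars and subdifferentials. -/

namespace IsAnisotropy

variable {φ : Plane → ℝ} (hφ : IsAnisotropy φ)
include hφ

lemma map_zero : φ 0 = 0 := by
  have := hφ.smul 0 0
  simpa using this

lemma map_neg (x : Plane) : φ (-x) = φ x := by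
  have := hφ.smul (-1) x
  simpa using this

lemma nonneg (x : Plane) : 0 ≤ φ x := by
  have := hφ.add_le x (-x)
  rw [add_neg_cancel, hφ.map_zero, hφ.map_neg] at this
  linarith

lemma pos {x : Plane} (hx : x ≠ 0) : 0 < φ x :=
  lt_of_le_of_ne (hφ.nonneg x) fun h => hx (hφ.eq_zero x h.symm)

lemma exists_upper : ∃ R : ℝ, 0 < R ∧ ∀ x, φ x ≤ R * ‖x‖ := by
  refine ⟨φ !₂[1, 0] + φ !₂[0, 1] + 1, ?_, fun x => ?_⟩
  · have := hφ.nonneg !₂[1, 0]; have := hφ.nonneg !₂[0, 1]; linarith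
  have hx : x = x 0 • (!₂[1, 0] : Plane) + x 1 • (!₂[0, 1] : Plane) := by
    apply Plane.ext_coords <;> simp
  have h := hφ.add_le (x 0 • (!₂[1, 0] : Plane)) (x 1 • (!₂[0, 1] : Plane))
  rw [← hx, hφ.smul, hφ.smul] at h
  have h0 : |x 0| ≤ ‖x‖ := by simpa using PiLp.norm_apply_le x 0
  have h1 : |x 1| ≤ ‖x‖ := by simpa using PiLp.norm_apply_le x 1
  have := hφ.nonneg !₂[1, 0]
  have := hφ.nonneg !₂[0, 1]
  nlinarith [norm_nonneg x]

lemma continuous : Continuous φ := by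
  obtain ⟨R, hR, h⟩ := hφ.exists_upper
  have : LipschitzWith R.toNNReal φ := by
    apply LipschitzWith.of_dist_le_mul
    intro x y
    rw [Real.dist_eq, dist_eq_norm, Real.coe_toNNReal _ hR.le, abs_le]
    have h1 := hφ.add_le (x - y) y
    have h2 := hφ.add_le (y - x) x
    rw [sub_add_cancel] at h1 h2
    have h3 := h (x - y)
    have h4 := h (y - x)
    rw [norm_sub_rev] at h4
    constructor <;> linarith
  exact this.continuous

lemma exists_lower : ∃ r : ℝ, 0 < r ∧ ∀ x, r * ‖x‖ ≤ φ x := by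
  have hne : (Metric.sphere (0 : Plane) 1).Nonempty := NormedSpace.sphere_nonempty.2 zero_le_one
  obtain ⟨z, hz, hmin⟩ := (isCompact_sphere (0 : Plane) 1).exists_isMinOn hne
    hφ.continuous.continuousOn
  have hz1 : ‖z‖ = 1 := by simpa using hz
  have hz0 : z ≠ 0 := by rintro rfl; simp at hz1
  refine ⟨φ z, hφ.pos hz0, fun x => ?_⟩
  by_cases hx : x = 0
  · simp [hx, hφ.map_zero]
  have hxn : 0 < ‖x‖ := norm_pos_iff.2 hx
  have h1 : φ z ≤ φ (‖x‖⁻¹ • x) := hmin (by simp [norm_smul, hxn.ne'])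
  rw [hφ.smul, abs_of_pos (inv_pos.2 hxn)] at h1
  calc φ z * ‖x‖ ≤ ‖x‖⁻¹ * φ x * ‖x‖ := by gcongr
    _ = φ x := by field_simp

lemma convex : ConvexOn ℝ univ φ := by
  refine ⟨convex_univ, fun x _ y _ a b ha hb _ => ?_⟩
  have h := hφ.add_le (a • x) (b • y)
  rw [hφ.smul, hφ.smul, abs_of_nonneg ha, abs_of_nonneg hb] at h
  simpa using h

lemma convex_ball : Convex ℝ {x | φ x ≤ 1} := by
  simpa using hφ.convex.convex_le 1

lemma isClosed_ball : IsClosed {x | φ x ≤ 1} := isClosed_le hφ.continuous continuous_const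

lemma inv_smul_eq_one {x : Plane} (hx : x ≠ 0) : φ ((φ x)⁻¹ • x) = 1 := by
  have := hφ.pos hx
  rw [hφ.smul, abs_of_pos (inv_pos.2 this), inv_mul_cancel₀ this.ne']

lemma polar_bddAbove (x : Plane) : BddAbove {r : ℝ | ∃ ξ : Plane, φ ξ ≤ 1 ∧ r = inner ℝ ξ x} := by
  obtain ⟨r, hr, h⟩ := hφ.exists_lower
  refine ⟨r⁻¹ * ‖x‖, ?_⟩
  rintro _ ⟨ξ, hξ, rfl⟩
  refine (real_inner_le_norm _ _).trans ?_
  gcongr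
  rw [← one_div, le_div_iff₀ hr]
  linarith [h ξ]

lemma inner_le_polar {ξ : Plane} (hξ : φ ξ ≤ 1) (x : Plane) : inner ℝ ξ x ≤ polar φ x :=
  le_csSup (hφ.polar_bddAbove x) ⟨ξ, hξ, rfl⟩

lemma polar_le {x : Plane} {M : ℝ} (h : ∀ ξ, φ ξ ≤ 1 → inner ℝ ξ x ≤ M) : polar φ x ≤ M := by
  refine csSup_le (s := {r : ℝ | ∃ ξ : Plane, φ ξ ≤ 1 ∧ r = inner ℝ ξ x})
    ⟨0, 0, by simp [hφ.map_zero], by simp⟩ ?_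
  rintro _ ⟨ξ, hξ, rfl⟩
  exact h ξ hξ

lemma polar_pos {x : Plane} (hx : x ≠ 0) : 0 < polar φ x := by
  have h := hφ.inner_le_polar (hφ.inv_smul_eq_one hx).le x
  rw [real_inner_smul_left, real_inner_self_eq_norm_sq] at h
  have := hφ.pos hx
  have := norm_pos_iff.2 hx
  have : 0 < (φ x)⁻¹ * ‖x‖ ^ 2 := by positivity
  linarith

lemma polar_smul {c : ℝ} (hc : 0 ≤ c) (x : Plane) : polar φ (c • x) = c * polar φ x := by
  rcases hc.eq_or_lt with rfl | hc
  · simp only [zero_smul, zero_mul]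
    exact le_antisymm (hφ.polar_le (by simp))
      (by simpa using hφ.inner_le_polar (ξ := 0) (by simp [hφ.map_zero]) 0)
  · have key : ∀ {c : ℝ} (_ : 0 < c) (x : Plane), polar φ (c • x) ≤ c * polar φ x := by
      intro c hc x
      refine hφ.polar_le fun ξ hξ => ?_
      rw [real_inner_smul_right]
      gcongr
      exact hφ.inner_le_polar hξ x
    refine le_antisymm (key hc x) ?_
    have h := key (inv_pos.2 hc) (c • x)
    rw [inv_smul_smul₀ hc.ne'] at h
    rwa [← div_eq_inv_mul, le_div_iff₀ hc, mul_comm] at h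

lemma polar_neg (x : Plane) : polar φ (-x) = polar φ x := by
  have key : ∀ x, polar φ (-x) ≤ polar φ x := fun x => hφ.polar_le fun ξ hξ => by
    have := hφ.inner_le_polar (ξ := -ξ) (by rwa [hφ.map_neg]) x
    simpa using this
  exact le_antisymm (key x) (by simpa using key (-x))

lemma inner_eq_of_mem_subdifferential {p ν : Plane} (h : p ∈ subdifferential (polar φ) ν) :
    inner ℝ p ν = polar φ ν := by
  have h0 := h 0
  have h2 := h ((2 : ℝ) • ν)
  rw [hφ.polar_smul (by norm_num)] at h2
  have h3 : polar φ 0 = 0 := by simpa using hφ.polar_smul (le_refl 0) 0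
  simp only [h3, zero_sub, inner_neg_right] at h0
  have h4 : (2 : ℝ) • ν - ν = ν := by rw [two_smul]; simp
  rw [h4] at h2
  linarith

lemma inner_le_of_mem_subdifferential {p ν : Plane} (h : p ∈ subdifferential (polar φ) ν)
    (y : Plane) : inner ℝ p y ≤ polar φ y := by
  have h0 := h y
  rw [inner_sub_right, hφ.inner_eq_of_mem_subdifferential h] at h0
  linarith

/-- Bipolar theorem: a point outside the closed unit ball is strictly separated from it by some `y`,
at which the polar is then too small. -/
lemma le_one_of_inner_le {p : Plane} (h : ∀ y, inner ℝ p y ≤ polar φ y) : φ p ≤ 1 := by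
  by_contra hp
  obtain ⟨f, u, hf, hu⟩ := geometric_hahn_banach_closed_point hφ.convex_ball hφ.isClosed_ball
    (x := p) hp
  set y := (InnerProductSpace.toDual ℝ Plane).symm f with hy
  have hfy : ∀ x, f x = inner ℝ x y := fun x => by
    rw [hy, real_inner_comm]; simp
  have h1 : polar φ y ≤ u := hφ.polar_le fun ξ hξ => by rw [← hfy]; exact (hf ξ hξ).le
  have h2 := h y
  rw [← hfy] at h2
  linarith

/-- Cahn–Hoffman vectors for `ν` form the face of the unit ball on which the linear form `ν` attains
its maximum. -/
lemma mem_subdifferential_iff {p ν : Plane} :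
    p ∈ subdifferential (polar φ) ν ↔ φ p ≤ 1 ∧ inner ℝ p ν = polar φ ν := by
  constructor
  · intro h
    exact ⟨hφ.le_one_of_inner_le (hφ.inner_le_of_mem_subdifferential h),
      hφ.inner_eq_of_mem_subdifferential h⟩
  · rintro ⟨h1, h2⟩ y
    rw [inner_sub_right, h2]
    linarith [hφ.inner_le_polar h1 y]

lemma one_le_of_polar_le_inner {x ν : Plane} (hν : ν ≠ 0) (h : polar φ ν ≤ inner ℝ x ν) :
    1 ≤ φ x := by
  have hp := hφ.polar_pos hν
  have hx : x ≠ 0 := by rintro rfl; simp at h; linarith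
  have h1 := hφ.inner_le_polar (hφ.inv_smul_eq_one hx).le ν
  rw [real_inner_smul_left] at h1
  have := hφ.pos hx
  rw [← div_eq_inv_mul, div_le_iff₀ this] at h1
  by_contra hlt
  push Not at hlt
  nlinarith

lemma eq_one_of_mem_subdifferential {p ν : Plane} (hν : ν ≠ 0)
    (h : p ∈ subdifferential (polar φ) ν) : φ p = 1 :=
  le_antisymm (hφ.mem_subdifferential_iff.1 h).1
    (hφ.one_le_of_polar_le_inner hν (hφ.mem_subdifferential_iff.1 h).2.ge)

/-- The midpoint of two points of the face exposed by `ν` is still on the supporting line, hence not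
in the open ball, while strong convexity would place it strictly inside. -/
lemma subdifferential_subsingleton (hell : IsElliptic φ) {ν : Plane} (hν : ν ≠ 0) {p q : Plane}
    (hp : p ∈ subdifferential (polar φ) ν) (hq : q ∈ subdifferential (polar φ) ν) : p = q := by
  obtain ⟨m, hm, hc⟩ := hell
  by_contra hne
  rw [hφ.mem_subdifferential_iff] at hp hq
  have hc' : UniformConvexOn univ (fun r => m / 2 * r ^ 2) (fun x => φ x ^ 2) := hc
  have hc'' := hc'.2
  have h := hc'' (mem_univ p) (mem_univ q) (a := 1 / 2) (b := 1 / 2) (by norm_num) (by norm_num)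
    (by norm_num)
  have h1 : 1 ≤ φ ((1 / 2 : ℝ) • p + (1 / 2 : ℝ) • q) := by
    apply hφ.one_le_of_polar_le_inner hν
    rw [inner_add_left, real_inner_smul_left, real_inner_smul_left, hp.2, hq.2]
    linarith
  have hpq : 0 < ‖p - q‖ := norm_pos_iff.2 (sub_ne_zero.2 hne)
  have h2 : 0 < m * ‖p - q‖ ^ 2 := by positivity
  simp only [smul_eq_mul] at h
  nlinarith [hφ.nonneg p, hφ.nonneg q, hp.1, hq.1]

lemma exists_support (p₀ : Plane) (h : φ p₀ = 1) :
    ∃ ν : Plane, inner ℝ p₀ ν = 1 ∧ ∀ ξ, inner ℝ ξ ν ≤ φ ξ := by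
  have hne : p₀ ≠ 0 := by rintro rfl; simp [hφ.map_zero] at h
  have hconv : Convex ℝ {x | φ x < 1} := by simpa using hφ.convex.convex_lt 1
  have hopen : IsOpen {x | φ x < 1} := isOpen_lt hφ.continuous continuous_const
  obtain ⟨f, hf⟩ := geometric_hahn_banach_open_point hconv hopen (x := p₀) (by simp [h])
  set y := (InnerProductSpace.toDual ℝ Plane).symm f with hy
  have hfy : ∀ x, f x = inner ℝ x y := fun x => by
    rw [hy, real_inner_comm]; simp
  have h0 : 0 < f p₀ := by simpa using hf 0 (by simp [hφ.map_zero])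
  refine ⟨(f p₀)⁻¹ • y, ?_, fun ξ => ?_⟩
  · rw [real_inner_smul_right, ← hfy, inv_mul_cancel₀ h0.ne']
  · rw [real_inner_smul_right, ← hfy, ← div_eq_inv_mul, div_le_iff₀ h0]
    by_contra hlt
    push Not at hlt
    -- The functional is controlled on the open ball only, so `ξ` is scaled by a number `t` strictly
    -- above `φ ξ`, which also covers `φ ξ = 0`.
    have hξ : ∀ t : ℝ, φ ξ < t → f ξ ≤ t * f p₀ := by
      intro t ht
      have ht0 : 0 < t := (hφ.nonneg ξ).trans_lt ht
      have := hf (t⁻¹ • ξ) (by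
        simp only [mem_ofPred_eq]
        rw [hφ.smul, abs_of_pos (inv_pos.2 ht0), ← div_eq_inv_mul, div_lt_one ht0]; exact ht)
      rw [ContinuousLinearMap.map_smul, smul_eq_mul, ← div_eq_inv_mul, div_lt_iff₀ ht0] at this
      linarith
    have h1 : φ ξ < f ξ / f p₀ := by rwa [lt_div_iff₀ h0]
    obtain ⟨t, ht1, ht2⟩ := exists_between h1
    have := hξ t ht1
    rw [lt_div_iff₀ h0] at ht2
    linarith

end IsAnisotropy

/-! ### Arc-length reparametrization of smooth closed curves. -/

/-- A smooth function with positive derivative which commutes with translations by periods has a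
smooth inverse with the same properties. -/
lemma exists_smooth_inverse {f : ℝ → ℝ} (hf : ContDiff ℝ ∞ f) (hpos : ∀ x, 0 < deriv f x)
    {p c : ℝ} (hc : 0 < c) (hper : ∀ x, f (x + p) = f x + c) :
    ∃ g : ℝ → ℝ, ContDiff ℝ ∞ g ∧ (∀ x, g (f x) = x) ∧ (∀ y, f (g y) = y) ∧ StrictMono g ∧
      ∀ y, g (y + c) = g y + p := by
  have hmono : StrictMono f := strictMono_of_deriv_pos hpos
  have hnat : ∀ (n : ℕ) x, f (x + n * p) = f x + n * c := by
    intro n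
    induction n with
    | zero => simp
    | succ k ih =>
      intro x
      have : x + (k + 1 : ℕ) * p = (x + k * p) + p := by push_cast; ring
      rw [this, hper, ih]; push_cast; ring
  have hsurj : Function.Surjective f := by
    intro y
    obtain ⟨n, hn⟩ := exists_nat_ge (|y - f 0| / c)
    rw [div_le_iff₀ hc] at hn
    refine mem_range_of_exists_le_of_exists_ge hf.continuous ⟨0 - n * p, ?_⟩ ⟨0 + n * p, ?_⟩
    · have := hnat n (0 - n * p)
      rw [sub_add_cancel] at this
      linarith [neg_abs_le (y - f 0)]
    · rw [hnat]; linarith [le_abs_self (y - f 0)]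
  let e : ℝ ≃o ℝ := hmono.orderIsoOfSurjective f hsurj
  have he : ∀ x, e x = f x := fun x => rfl
  have hl : ∀ x, e.symm (f x) = x := fun x => by rw [← he]; exact e.symm_apply_apply x
  have hr : ∀ y, f (e.symm y) = y := fun y => by rw [← he]; exact e.apply_symm_apply y
  refine ⟨e.symm, ?_, hl, hr, e.symm.strictMono, fun y => ?_⟩
  · rw [contDiff_iff_contDiffAt]
    intro y
    exact OpenPartialHomeomorph.contDiffAt_symm_deriv (f := e.toHomeomorph.toOpenPartialHomeomorph)
      (f₀' := deriv f (e.symm y)) (hpos _).ne' (mem_univ _)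
      ((hf.differentiable (by simp) _).hasDerivAt) hf.contDiffAt
  · apply hmono.injective
    rw [hr, hper, hr]

/-- Reparametrization by arc length of a regular smooth periodic curve. -/
lemma exists_arcLength_inverse {P : ℝ → Plane} (hP : ContDiff ℝ ∞ P) (hreg : ∀ x, deriv P x ≠ 0)
    {T : ℝ} (hT : 0 < T) (hper : Function.Periodic P T) :
    ∃ (f g : ℝ → ℝ) (L : ℝ), 0 < L ∧ ContDiff ℝ ∞ f ∧ ContDiff ℝ ∞ g ∧ f 0 = 0 ∧
      StrictMono f ∧ (∀ x, HasDerivAt f ‖deriv P x‖ x) ∧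
      (∀ x, f (x + T) = f x + L) ∧ (∀ y, g (y + L) = g y + T) ∧
      (∀ x, g (f x) = x) ∧ (∀ y, f (g y) = y) ∧
      (∀ y, HasDerivAt g (‖deriv P (g y)‖⁻¹) y) ∧
      ∀ y, HasDerivAt (fun y => P (g y)) (‖deriv P (g y)‖⁻¹ • deriv P (g y)) y := by
  have hd : ContDiff ℝ ∞ (deriv P) := (contDiff_infty_iff_deriv.1 hP).2
  have hn : ContDiff ℝ ∞ (fun x => ‖deriv P x‖) := hd.norm ℝ hreg
  have hdper : Function.Periodic (fun x => ‖deriv P x‖) T := fun x => by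
    have h1 : deriv (fun y => P (y + T)) x = deriv P (x + T) := deriv_comp_add_const P T x
    have h2 : (fun y => P (y + T)) = P := funext hper
    simp only
    rw [← h1, h2]
  set f : ℝ → ℝ := fun x => ∫ t in (0 : ℝ)..x, ‖deriv P t‖ with hf
  have hfd : ∀ x, HasDerivAt f ‖deriv P x‖ x := fun x =>
    intervalIntegral.integral_hasDerivAt_right (hn.continuous.intervalIntegrable _ _)
      hn.continuous.stronglyMeasurable.stronglyMeasurableAtFilter hn.continuous.continuousAt
  have hfderiv : deriv f = fun x => ‖deriv P x‖ := funext fun x => (hfd x).deriv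
  have hfs : ContDiff ℝ ∞ f := by
    rw [contDiff_infty_iff_deriv, hfderiv]
    exact ⟨fun x => (hfd x).differentiableAt, hn⟩
  have hpos : ∀ x, 0 < deriv f x := fun x => by
    rw [hfderiv]; exact norm_pos_iff.2 (hreg x)
  have hmono : StrictMono f := strictMono_of_deriv_pos hpos
  have hf0 : f 0 = 0 := by simp [hf]
  have hL : 0 < f T := by rw [← hf0]; exact hmono hT
  have hfT : ∀ x, f (x + T) = f x + f T := fun x => by
    simp only [hf]
    have h1 := hdper.intervalIntegral_add_eq x 0
    rw [zero_add] at h1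
    rw [← h1]
    exact (intervalIntegral.integral_add_adjacent_intervals
      (hn.continuous.intervalIntegrable _ _) (hn.continuous.intervalIntegrable _ _)).symm
  obtain ⟨g, hgs, hgf, hfg, hgm, hgT⟩ := exists_smooth_inverse hfs hpos hL hfT
  have hgd : ∀ y, HasDerivAt g (‖deriv P (g y)‖⁻¹) y := fun y =>
    HasDerivAt.of_local_left_inverse hgs.continuous.continuousAt (hfd (g y))
      (norm_ne_zero_iff.2 (hreg _)) (Eventually.of_forall hfg)
  refine ⟨f, g, f T, hL, hfs, hgs, hf0, hmono, hfd, hfT, hgT, hgf, hfg, hgd, fun y => ?_⟩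
  exact ((hP.differentiable (by simp) (g y)).hasDerivAt).scomp y (hgd y)

/-! ### The unit sphere of a smooth norm as a closed curve. -/

/-- `p` runs anticlockwise with unit speed along the unit sphere `{φ = 1}`. -/
structure IsUnitSphereParam (φ : Plane → ℝ) (p : ℝ → Plane) : Prop where
  smooth : ContDiff ℝ ∞ p
  speed : ∀ x, ‖deriv p x‖ = 1
  mem : ∀ x, φ (p x) = 1
  turn : ∀ x, 0 < inner ℝ (perp (p x)) (deriv p x)
  translate : ∀ a b, p a = p b → Function.Periodic p (a - b)
  exists_period : ∃ c, 0 < c ∧ Function.Periodic p c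
  exists_near : ∃ K, 0 < K ∧ ∀ a Q, φ Q = 1 → ∃ b, p b = Q ∧ |b - a| ≤ K * ‖Q - p a‖

/-- The unit vector with a given polar angle. -/
noncomputable def angleVec (α : ℝ) : Plane := !₂[Real.cos α, Real.sin α]

@[simp] lemma angleVec_zero_coord (α : ℝ) : angleVec α 0 = Real.cos α := rfl
@[simp] lemma angleVec_one_coord (α : ℝ) : angleVec α 1 = Real.sin α := rfl

lemma norm_angleVec (α : ℝ) : ‖angleVec α‖ = 1 := by
  have := Plane.norm_sq_eq (angleVec α)
  simp only [angleVec_zero_coord, angleVec_one_coord, Real.cos_sq_add_sin_sq] at this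
  exact by nlinarith [norm_nonneg (angleVec α)]

lemma angleVec_ne_zero (α : ℝ) : angleVec α ≠ 0 := by
  intro h; have := norm_angleVec α; simp [h] at this

lemma contDiff_angleVec : ContDiff ℝ ∞ angleVec := by
  rw [contDiff_euclidean]
  intro i
  fin_cases i
  · exact Real.contDiff_cos
  · exact Real.contDiff_sin

lemma hasDerivAt_angleVec (α : ℝ) : HasDerivAt angleVec (perp (angleVec α)) α := by
  have h : HasDerivAt (fun α => (fun i => angleVec α i : Fin 2 → ℝ))
      (fun i => perp (angleVec α) i) α := by
    rw [hasDerivAt_pi]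
    intro i
    fin_cases i
    · exact Real.hasDerivAt_cos α
    · exact Real.hasDerivAt_sin α
  have h2 := ((EuclideanSpace.equiv (Fin 2) ℝ).symm.hasFDerivAt (x := fun i => angleVec α i)).comp_hasDerivAt α h
  exact h2

lemma angleVec_periodic : Function.Periodic angleVec (2 * Real.pi) := fun x => by
  apply Plane.ext_coords <;> simp

lemma exists_angleVec_eq_near {v : Plane} (hv : ‖v‖ = 1) (α : ℝ) :
    ∃ β, angleVec β = v ∧ |β - α| ≤ Real.pi / 2 * ‖v - angleVec α‖ := by
  set x := (inner ℝ v (angleVec α) : ℝ) with hx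
  set y := (inner ℝ v (perp (angleVec α)) : ℝ) with hy
  have hxy : x ^ 2 + y ^ 2 = 1 := by
    rw [hx, hy, ← norm_sq_frame (norm_angleVec α), hv]; norm_num
  set z : ℂ := ⟨x, y⟩ with hz
  have hz1 : ‖z‖ = 1 := by
    have : ‖z‖ ^ 2 = 1 := by rw [Complex.sq_norm, Complex.normSq_apply]; simp [hz]; linarith
    exact by nlinarith [norm_nonneg z]
  have hz0 : z ≠ 0 := by rintro h; rw [h] at hz1; simp at hz1
  have hc : Real.cos z.arg = x := by rw [Complex.cos_arg hz0, hz1]; simp [hz]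
  have hs : Real.sin z.arg = y := by rw [Complex.sin_arg, hz1]; simp [hz]
  refine ⟨α + z.arg, ?_, ?_⟩
  · rw [eq_frame (norm_angleVec α) v, ← hx, ← hy]
    apply Plane.ext_coords
    · simp [Real.cos_add, hc, hs]; ring
    · simp [Real.sin_add, hc, hs]; ring
  · rw [add_sub_cancel_left]
    -- The bound `cos θ ≤ 1 - 2 θ² / π²` for `|θ| ≤ π` compares angle with chord; this is the source
    -- of the factor `π / 2`.
    have h1 := Real.cos_le_one_sub_mul_cos_sq (Complex.abs_arg_le_pi z)
    rw [hc] at h1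
    have h2 : ‖v - angleVec α‖ ^ 2 = 2 - 2 * x := by
      rw [norm_sub_sq_real, hv, norm_angleVec, ← hx]; ring
    apply abs_le_of_sq_le_sq' _ (by positivity) |> abs_le.2
    rw [mul_pow, h2]
    have hpi := Real.pi_pos
    have h3 : 2 / Real.pi ^ 2 * z.arg ^ 2 * (Real.pi ^ 2 / 2) = z.arg ^ 2 := by field_simp
    nlinarith [sq_nonneg Real.pi, mul_le_mul_of_nonneg_right h1 (by positivity : 0 ≤ Real.pi ^ 2 / 2)]

lemma angleVec_eq_iff {a b : ℝ} (h : angleVec a = angleVec b) :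
    ∃ k : ℤ, a = b + k * (2 * Real.pi) := by
  have h0 : Real.cos a = Real.cos b := congrArg (fun v : Plane => v 0) h
  have h1 : Real.sin a = Real.sin b := congrArg (fun v : Plane => v 1) h
  obtain ⟨k, hk⟩ := Real.Angle.angle_eq_iff_two_pi_dvd_sub.1 (Real.Angle.cos_sin_inj h0 h1)
  exact ⟨k, by linarith⟩

lemma norm_inv_smul_sub_le {x y : Plane} (hx : x ≠ 0) (hy : y ≠ 0) :
    ‖‖x‖⁻¹ • x - ‖y‖⁻¹ • y‖ ≤ 2 * ‖y‖⁻¹ * ‖x - y‖ := by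
  have hx' := norm_pos_iff.2 hx
  have hy' := norm_pos_iff.2 hy
  have h : ‖x‖⁻¹ • x - ‖y‖⁻¹ • y = ‖y‖⁻¹ • (x - y) + (‖y‖⁻¹ * (‖y‖ - ‖x‖) * ‖x‖⁻¹) • x := by
    have : ‖y‖⁻¹ * (‖y‖ - ‖x‖) * ‖x‖⁻¹ = ‖x‖⁻¹ - ‖y‖⁻¹ := by field_simp
    rw [this, smul_sub, sub_smul]; abel
  rw [h]
  refine (norm_add_le _ _).trans ?_
  rw [norm_smul, norm_smul, norm_mul, norm_mul, norm_inv, norm_norm, norm_inv, norm_norm,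
    mul_assoc _ (‖x‖⁻¹) ‖x‖, inv_mul_cancel₀ hx'.ne', mul_one]
  have := abs_norm_sub_norm_le y x
  rw [norm_sub_rev] at this
  rw [Real.norm_eq_abs]
  nlinarith [mul_le_mul_of_nonneg_left this (inv_pos.2 hy').le]

/-- In polar coordinates the sphere is the graph of `h = 1 / φ` over the circle, smooth because `φ`
is smooth off the origin. Its angle determines the parameter up to periods, and nearby points have
nearby angles, which yields the comparison of arc with chord. -/
lemma IsAnisotropy.exists_unitSphereParam {φ : Plane → ℝ} (hφ : IsAnisotropy φ)
    (hs : ContDiffOn ℝ ∞ φ {0}ᶜ) : ∃ p, IsUnitSphereParam φ p := by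
  set h : ℝ → ℝ := fun α => (φ (angleVec α))⁻¹ with hh
  have hhpos : ∀ α, 0 < h α := fun α => inv_pos.2 (hφ.pos (angleVec_ne_zero α))
  have hhs : ContDiff ℝ ∞ h := by
    have h1 : ContDiff ℝ ∞ (fun α => φ (angleVec α)) := by
      rw [← contDiffOn_univ]
      exact hs.comp contDiff_angleVec.contDiffOn fun α _ => angleVec_ne_zero α
    exact h1.inv fun α => (hφ.pos (angleVec_ne_zero α)).ne'
  set P : ℝ → Plane := fun α => h α • angleVec α with hP
  have hPs : ContDiff ℝ ∞ P := hhs.smul contDiff_angleVec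
  have hPd : ∀ α, HasDerivAt P (h α • perp (angleVec α) + deriv h α • angleVec α) α := fun α =>
    ((hhs.differentiable (by simp) α).hasDerivAt).smul (hasDerivAt_angleVec α)
  have hturn : ∀ α, inner ℝ (perp (P α)) (deriv P α) = h α ^ 2 := fun α => by
    rw [(hPd α).deriv, hP]
    simp only [perp_smul]
    rw [inner_add_right, real_inner_smul_left, real_inner_smul_right, real_inner_smul_left,
      real_inner_smul_right, inner_perp_self, real_inner_self_eq_norm_sq, norm_perp, norm_angleVec]
    ring
  have hreg : ∀ α, deriv P α ≠ 0 := fun α h0 => by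
    have := hturn α
    rw [h0, inner_zero_right] at this
    have := hhpos α
    nlinarith [sq_pos_of_pos this]
  have hPper : Function.Periodic P (2 * Real.pi) := fun α => by
    simp only [hP, hh, angleVec_periodic α]
  have hnP : ∀ α, ‖P α‖ = h α := fun α => by
    simp [hP, norm_smul, norm_angleVec, abs_of_pos (hhpos α)]
  have hPdir : ∀ α, ‖P α‖⁻¹ • P α = angleVec α := fun α => by
    rw [hnP]; simp only [hP]; rw [inv_smul_smul₀ (hhpos α).ne']
  have hPφ : ∀ α, φ (P α) = 1 := fun α => hφ.inv_smul_eq_one (angleVec_ne_zero α)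
  obtain ⟨f, g, L, hL, hfs, hgs, hf0, hfm, hfd, hfT, hgT, hgf, hfg, hgd, hpd⟩ :=
    exists_arcLength_inverse hPs hreg Real.two_pi_pos hPper
  have hper : Function.Periodic (fun y => P (g y)) L := fun y => by
    simp only [hgT]; exact hPper _
  refine ⟨fun y => P (g y), hPs.comp hgs, fun x => ?_, fun x => hPφ _, fun x => ?_,
    fun a b hab => ?_, ⟨L, hL, hper⟩, ?_⟩
  · rw [(hpd x).deriv, norm_smul, norm_inv, norm_norm,
      inv_mul_cancel₀ (norm_ne_zero_iff.2 (hreg _))]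
  · rw [(hpd x).deriv, real_inner_smul_right, hturn]
    have := norm_pos_iff.2 (hreg (g x))
    have := hhpos (g x)
    positivity
  · have h1 : angleVec (g a) = angleVec (g b) := by
      rw [← hPdir (g a), ← hPdir (g b), hab]
    obtain ⟨k, hk⟩ := angleVec_eq_iff h1
    have h2 : ∀ (k : ℤ) y, g (y + k * L) = g y + k * (2 * Real.pi) := by
      intro k y
      induction k with
      | zero => simp
      | succ i ih =>
        have : y + ((i : ℤ) + 1 : ℤ) * L = (y + (i : ℤ) * L) + L := by push_cast; ring
        rw [this, hgT, ih]; push_cast; ring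
      | pred i ih =>
        have := hgT (y + (-(i : ℤ) - 1 : ℤ) * L)
        have h3 : y + (-(i : ℤ) - 1 : ℤ) * L + L = y + (-(i : ℤ) : ℤ) * L := by push_cast; ring
        rw [h3, ih] at this
        push_cast at this ⊢
        linarith
    have h3 : a - b = k * L := by
      have : g a = g (b + k * L) := by rw [h2, hk]
      have := congrArg f this
      rw [hfg, hfg] at this
      linarith
    rw [h3]
    exact hper.int_mul k
  · obtain ⟨M, hM⟩ : ∃ M, ∀ α, ‖deriv P α‖ ≤ M := by
      have hdper : Function.Periodic (deriv P) (2 * Real.pi) := fun x => by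
        have h1 := deriv_comp_add_const P (2 * Real.pi) x
        have h2 : (fun y => P (y + 2 * Real.pi)) = P := funext hPper
        rw [← h1, h2]
      have hb := hdper.isBounded_of_continuous Real.two_pi_pos.ne'
        (contDiff_infty_iff_deriv.1 hPs).2.continuous
      obtain ⟨M, hM⟩ := hb.exists_norm_le
      exact ⟨M, fun α => hM _ ⟨α, rfl⟩⟩
    obtain ⟨R, hR, hRφ⟩ := hφ.exists_upper
    have hM0 : 0 < M := (norm_pos_iff.2 (hreg 0)).trans_le (hM 0)
    refine ⟨M * (Real.pi / 2 * (2 * R)), by have := Real.pi_pos; positivity, fun a Q hQ => ?_⟩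
    have hQ0 : Q ≠ 0 := by rintro rfl; simp [hφ.map_zero] at hQ
    have hQn := norm_pos_iff.2 hQ0
    have hP0 : P (g a) ≠ 0 := norm_pos_iff.1 (by rw [hnP]; exact hhpos _)
    obtain ⟨β, hβ, hβd⟩ := exists_angleVec_eq_near (v := ‖Q‖⁻¹ • Q) (by
      rw [norm_smul, norm_inv, norm_norm, inv_mul_cancel₀ hQn.ne']) (g a)
    have hQβ : P β = Q := by
      simp only [hP, hh]
      rw [hβ, hφ.smul, hQ, abs_of_pos (inv_pos.2 hQn), mul_one, inv_inv, smul_inv_smul₀ hQn.ne']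
    refine ⟨f β, by simp only [hgf]; exact hQβ, ?_⟩
    have hlip : |f β - a| ≤ M * |β - g a| := by
      have h1 : ∀ x, ‖deriv f x‖ ≤ M := fun x => by
        rw [(hfd x).deriv, norm_norm]; exact hM x
      have := Convex.norm_image_sub_le_of_norm_deriv_le (s := univ) (f := f)
        (fun x _ => (hfd x).differentiableAt) (fun x _ => h1 x) convex_univ (mem_univ (g a))
        (mem_univ β)
      rwa [hfg] at this
    have hdir := norm_inv_smul_sub_le hQ0 hP0
    rw [hPdir] at hdir
    have hRle : ‖P (g a)‖⁻¹ ≤ R := by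
      rw [inv_le_comm₀ (norm_pos_iff.2 hP0) hR, ← one_div, div_le_iff₀ hR]
      have := hRφ (P (g a))
      rw [hPφ] at this; linarith
    have hpi := Real.pi_pos
    calc |f β - a| ≤ M * |β - g a| := hlip
      _ ≤ M * (Real.pi / 2 * (2 * ‖P (g a)‖⁻¹ * ‖Q - P (g a)‖)) := by
          gcongr; exact hβd.trans (by gcongr)
      _ ≤ M * (Real.pi / 2 * (2 * R * ‖Q - P (g a)‖)) := by gcongr
      _ = _ := by ring

/-- A continuous periodic function on the line is uniformly continuous. -/
lemma Function.Periodic.uniformContinuous_of_continuous {E : Type*} [PseudoMetricSpace E]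
    {f : ℝ → E} {c : ℝ} (hc : 0 < c) (hper : Function.Periodic f c) (hf : Continuous f) :
    UniformContinuous f := by
  have h1 : UniformContinuousOn f (Icc (-c) (2 * c)) :=
    isCompact_Icc.uniformContinuousOn_of_continuous hf.continuousOn
  rw [Metric.uniformContinuousOn_iff] at h1
  rw [Metric.uniformContinuous_iff]
  intro ε hε
  obtain ⟨δ, hδ, h⟩ := h1 ε hε
  refine ⟨min δ c, lt_min hδ hc, fun {x y} hxy => ?_⟩
  obtain ⟨k, hk, -⟩ := existsUnique_sub_zsmul_mem_Ico hc x 0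
  rw [zero_add, zsmul_eq_mul] at hk
  have e1 : f (x - k * c) = f x := by simpa using hper.sub_zsmul_eq k
  have e2 : f (y - k * c) = f y := by simpa using hper.sub_zsmul_eq k
  rw [← e1, ← e2]
  rw [Real.dist_eq, lt_min_iff] at hxy
  have := abs_lt.1 hxy.2
  apply h
  · exact ⟨by linarith [hk.1], by linarith [hk.2]⟩
  · exact ⟨by linarith [hk.1], by linarith [hk.2]⟩
  · rw [Real.dist_eq, sub_sub_sub_cancel_right]; exact hxy.1

lemma Function.Periodic.deriv_periodic {p : ℝ → Plane} {c : ℝ} (h : Function.Periodic p c) :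
    Function.Periodic (deriv p) c := fun x => by
  have h1 := deriv_comp_add_const p c x
  have h2 : (fun y => p (y + c)) = p := funext h
  rw [← h1, h2]

/-- The Binet–Cauchy identity, with `inner (perp x) y` as the cross product. -/
lemma cross_mul_cross (m n p d : Plane) :
    inner ℝ (perp m) n * inner ℝ (perp p) d =
      -(inner ℝ d m * inner ℝ p n) + inner ℝ d n * inner ℝ p m := by
  simp only [Plane.inner_eq, perp_zero_coord, perp_one_coord]; ring

/-- If `v` lies on the arc of the unit circle from `u` to `w`, and this arc is contained in an open
half circle, then `v` is not further from `u` than twice the distance from `u` to `w`. -/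
lemma norm_sub_le_of_cross_nonneg {u v w q : Plane} (hu : ‖u‖ = 1) (hv : ‖v‖ = 1) (hw : ‖w‖ = 1)
    (huv : 0 ≤ (inner ℝ (perp u) v : ℝ)) (hvw : 0 ≤ (inner ℝ (perp v) w : ℝ))
    (huw : 0 ≤ (inner ℝ (perp u) w : ℝ)) (hqu : 0 < (inner ℝ u q : ℝ))
    (hqv : 0 < (inner ℝ v q : ℝ)) :
    ‖v - u‖ ≤ 2 * ‖u - w‖ := by
  have hv2 := Plane.norm_sq_eq v
  rw [hv] at hv2
  have e1 : (inner ℝ u w : ℝ) = inner ℝ u v * inner ℝ v w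
      - inner ℝ (perp u) v * inner ℝ (perp v) w := by
    simp only [Plane.inner_eq, perp_zero_coord, perp_one_coord]
    linear_combination (u 0 * w 0 + u 1 * w 1) * hv2
  have e2 : (inner ℝ (perp u) w : ℝ) = inner ℝ (perp u) v * inner ℝ v w
      + inner ℝ u v * inner ℝ (perp v) w := by
    simp only [Plane.inner_eq, perp_zero_coord, perp_one_coord]
    linear_combination (u 0 * w 1 - u 1 * w 0) * hv2
  have n1 : ‖v - u‖ ^ 2 = 2 - 2 * inner ℝ u v := by
    rw [norm_sub_sq_real, hu, hv, real_inner_comm]; ring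
  have n2 : ‖u - w‖ ^ 2 = 2 - 2 * inner ℝ u w := by
    rw [norm_sub_sq_real, hu, hw]; ring
  have b1 : (inner ℝ v w : ℝ) ≤ 1 := by
    have := real_inner_le_norm v w; rwa [hv, hw, one_mul] at this
  have b2 : -1 ≤ (inner ℝ u v : ℝ) := by
    have := neg_le_of_abs_le (abs_real_inner_le_norm u v); rwa [hu, hv, one_mul] at this
  suffices h : ‖v - u‖ ^ 2 ≤ (2 * ‖u - w‖) ^ 2 from
    (pow_le_pow_iff_left₀ (norm_nonneg _) (by positivity) two_ne_zero).1 h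
  rw [mul_pow, n1, n2]
  rcases le_or_gt (inner ℝ u w : ℝ) 0 with h | h
  -- An angle of at least a right angle makes `‖u - w‖² ≥ 2`, while two unit vectors are never more
  -- than `2` apart.
  · linarith
  have h3 : 0 < (inner ℝ u v : ℝ) * inner ℝ v w := by nlinarith [mul_nonneg huv hvw]
  rcases pos_and_pos_or_neg_and_neg_of_mul_pos h3 with ⟨h4, h5⟩ | ⟨h4, h5⟩
  · have h6 : (inner ℝ u w : ℝ) ≤ 1 := by
      have := real_inner_le_norm u w; rwa [hu, hw, one_mul] at this
    nlinarith [mul_nonneg huv hvw]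
  -- Two negative cosines force the sine between `u` and `v` to vanish, so `u` is a negative
  -- multiple of `v`, contrary to the open half plane.
  · exfalso
    have h6 : (inner ℝ (perp u) v : ℝ) = 0 := by nlinarith [mul_nonneg huv (neg_pos.2 h5).le]
    have h7 := eq_frame hv u
    have h8 : (inner ℝ u (perp v) : ℝ) = 0 := by
      have := inner_perp_left u v; linarith
    rw [h8, zero_smul, add_zero] at h7
    rw [h7, real_inner_smul_left] at hqu
    nlinarith

/-! ### Convexity of the unit sphere: outer normals and turning of the tangent. -/

namespace IsUnitSphereParam

variable {φ : Plane → ℝ} {p : ℝ → Plane} (hp : IsUnitSphereParam φ p) (hφ : IsAnisotropy φ)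
include hp

lemma hasDerivAt (a : ℝ) : HasDerivAt p (deriv p a) a :=
  (hp.smooth.differentiable (by simp) a).hasDerivAt

lemma contDiff_deriv : ContDiff ℝ ∞ (deriv p) := (contDiff_infty_iff_deriv.1 hp.smooth).2

lemma norm_normal (a : ℝ) : ‖-perp (deriv p a)‖ = 1 := by rw [norm_neg, norm_perp, hp.speed]

lemma norm_sub_le (a b : ℝ) : ‖p b - p a‖ ≤ |b - a| := by
  have := Convex.norm_image_sub_le_of_norm_deriv_le (s := univ) (f := p) (C := 1)
    (fun x _ => (hp.hasDerivAt x).differentiableAt) (fun x _ => (hp.speed x).le) convex_univ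
    (mem_univ a) (mem_univ b)
  simpa using this

lemma uniformContinuous_deriv : UniformContinuous (deriv p) := by
  obtain ⟨c, hc, hper⟩ := hp.exists_period
  exact hper.deriv_periodic.uniformContinuous_of_continuous hc hp.contDiff_deriv.continuous

lemma inner_perp_deriv_neg (a : ℝ) : (inner ℝ (p a) (perp (deriv p a)) : ℝ) < 0 := by
  have h1 := hp.turn a
  rw [inner_perp_left] at h1
  linarith

include hφ

/-- `-perp (deriv p a)` is the outer normal at `p a`. A supporting form there is maximal along `p`
at `a`, hence orthogonal to the tangent, and anticlockwise motion fixes its sign. -/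
lemma inner_le_inner (a : ℝ) {ξ : Plane} (hξ : φ ξ ≤ 1) :
    (inner ℝ ξ (-perp (deriv p a)) : ℝ) ≤ inner ℝ (p a) (-perp (deriv p a)) := by
  obtain ⟨ν, h1, h2⟩ := hφ.exists_support (p a) (hp.mem a)
  have hmax : IsLocalMax (fun x => (inner ℝ (p x) ν : ℝ)) a := by
    refine Eventually.of_forall fun x => ?_
    simp only
    rw [h1]
    exact (h2 _).trans_eq (hp.mem x)
  have hd : HasDerivAt (fun x => (inner ℝ (p x) ν : ℝ)) (inner ℝ (deriv p a) ν) a := by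
    simpa using (hp.hasDerivAt a).inner ℝ (hasDerivAt_const a ν)
  have h3 := hmax.hasDerivAt_eq_zero hd
  have h4 := eq_frame (hp.speed a) ν
  rw [real_inner_comm, h3, zero_smul, zero_add] at h4
  set c : ℝ := inner ℝ ν (perp (deriv p a))
  have h5 := hp.inner_perp_deriv_neg a
  have h6 := (h2 ξ).trans hξ
  rw [h4, real_inner_smul_right] at h6 h1
  have hc : c < 0 := by
    by_contra hc; push Not at hc; nlinarith
  rw [inner_neg_right, inner_neg_right]
  nlinarith

lemma mem_subdifferential (a : ℝ) : p a ∈ subdifferential (polar φ) (-perp (deriv p a)) := by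
  rw [hφ.mem_subdifferential_iff]
  exact ⟨(hp.mem a).le, le_antisymm (hφ.inner_le_polar (hp.mem a).le _)
    (hφ.polar_le fun ξ hξ => hp.inner_le_inner hφ a hξ)⟩

/-- The unit ball contains the disc of radius `1 / R`, so every supporting line has at least this
distance from the origin. Arcs shorter than `1 / R` therefore keep all their points on the positive
side of each other's normals. -/
lemma inv_le_inner_normal {R : ℝ} (hR : 0 < R) (h : ∀ x, φ x ≤ R * ‖x‖) (a : ℝ) :
    R⁻¹ ≤ (inner ℝ (p a) (-perp (deriv p a)) : ℝ) := by
  have h1 := hp.inner_le_inner hφ a (ξ := R⁻¹ • (-perp (deriv p a))) (by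
    refine (h _).trans ?_
    rw [norm_smul, hp.norm_normal, norm_inv, Real.norm_of_nonneg hR.le, mul_one,
      mul_inv_cancel₀ hR.ne'])
  rwa [real_inner_smul_left, real_inner_self_eq_norm_sq, hp.norm_normal, one_pow, mul_one] at h1

lemma inner_normal_pos {R : ℝ} (hR : 0 < R) (h : ∀ x, φ x ≤ R * ‖x‖) {a b : ℝ}
    (hab : |b - a| < R⁻¹) : 0 < (inner ℝ (p a) (-perp (deriv p b)) : ℝ) := by
  have h1 := hp.inv_le_inner_normal hφ hR h b
  have h2 := real_inner_le_norm (p b - p a) (-perp (deriv p b))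
  rw [hp.norm_normal, mul_one, inner_sub_left] at h2
  linarith [hp.norm_sub_le a b]

lemma cross_pos {R : ℝ} (hR : 0 < R) (h : ∀ x, φ x ≤ R * ‖x‖) {a b : ℝ} (hab : a < b)
    (hba : b - a < R⁻¹) : 0 < (inner ℝ (perp (p a)) (p b) : ℝ) := by
  have hd : ∀ x, HasDerivAt (fun x => (inner ℝ (perp (p a)) (p x) : ℝ))
      (inner ℝ (perp (p a)) (deriv p x)) x := fun x => by
    simpa using (hasDerivAt_const x (perp (p a))).inner ℝ (hp.hasDerivAt x)
  have hmono : StrictMonoOn (fun x => (inner ℝ (perp (p a)) (p x) : ℝ)) (Icc a b) := by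
    apply strictMonoOn_of_deriv_pos (convex_Icc a b)
    · exact fun x _ => (hd x).continuousAt.continuousWithinAt
    · intro x hx
      rw [interior_Icc] at hx
      rw [(hd x).deriv, inner_perp_left, ← inner_neg_right]
      apply hp.inner_normal_pos hφ hR h
      rw [abs_of_pos (by linarith [hx.1])]
      linarith [hx.2]
  have := hmono (left_mem_Icc.2 hab.le) (right_mem_Icc.2 hab.le) hab
  simpa [inner_perp_self] using this

/-- Each end of the arc lies below the supporting line at the other end. The Binet–Cauchy identity
turns these two inequalities into the sign of the turning of the normal. -/
lemma cross_deriv_nonneg {R : ℝ} (hR : 0 < R) (h : ∀ x, φ x ≤ R * ‖x‖) {a b : ℝ} (hab : a ≤ b)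
    (hba : b - a < R⁻¹) : 0 ≤ (inner ℝ (perp (deriv p a)) (deriv p b) : ℝ) := by
  rcases hab.eq_or_lt with rfl | hab
  · rw [inner_perp_self]
  have h1 := hp.cross_pos hφ hR h hab hba
  have h2 := cross_mul_cross (-perp (deriv p a)) (-perp (deriv p b)) (p a) (p b - p a)
  have e1 : (inner ℝ (perp (-perp (deriv p a))) (-perp (deriv p b)) : ℝ)
      = inner ℝ (perp (deriv p a)) (deriv p b) := by
    rw [perp_neg, inner_neg_left, inner_neg_right, neg_neg, inner_perp_perp]
  have e2 : (inner ℝ (perp (p a)) (p b - p a) : ℝ) = inner ℝ (perp (p a)) (p b) := by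
    rw [inner_sub_right, inner_perp_self, sub_zero]
  rw [e1, e2] at h2
  have h3 := hp.inner_le_inner hφ a (hp.mem b).le
  have h4 := hp.inner_le_inner hφ b (hp.mem a).le
  have h5 := hp.inner_normal_pos hφ hR h (a := a) (b := a) (by simpa using hR)
  have h6 := hp.inner_normal_pos hφ hR h (a := a) (b := b) (by
    rwa [abs_of_pos (by linarith)])
  rw [inner_sub_left, inner_sub_left] at h2
  by_contra hneg
  push Not at hneg
  nlinarith [mul_nonneg (sub_nonneg.2 h3) h6.le, mul_nonneg (sub_nonneg.2 h4) h5.le]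

/-- Along a short arc the tangent stays close to the tangents at the end points. -/
lemma norm_deriv_sub_le {R : ℝ} (hR : 0 < R) (h : ∀ x, φ x ≤ R * ‖x‖) {a b x : ℝ}
    (hx : x ∈ uIcc a b) (hab : |b - a| < R⁻¹) :
    ‖deriv p x - deriv p a‖ ≤ 3 * ‖deriv p a - deriv p b‖ := by
  have key : ∀ {a b : ℝ}, a ≤ x → x ≤ b → b - a < R⁻¹ →
      ‖deriv p x - deriv p a‖ ≤ 2 * ‖deriv p a - deriv p b‖ := by
    intro a b hax hxb hab
    have hpos : ∀ y, |y - a| < R⁻¹ → 0 < (inner ℝ (deriv p y) (perp (p a)) : ℝ) := by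
      intro y hy
      have := hp.inner_normal_pos hφ hR h hy
      rw [real_inner_comm, inner_perp_left]
      rwa [inner_neg_right] at this
    exact norm_sub_le_of_cross_nonneg (q := perp (p a)) (hp.speed a) (hp.speed x) (hp.speed b)
      (hp.cross_deriv_nonneg hφ hR h hax (by linarith))
      (hp.cross_deriv_nonneg hφ hR h hxb (by linarith))
      (hp.cross_deriv_nonneg hφ hR h (hax.trans hxb) hab)
      (hpos a (by simpa using hR)) (hpos x (by rw [abs_of_nonneg (by linarith)]; linarith))
  -- If `a` is the right end point, the estimate is made from `b`, and the triangle inequality adds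
  -- one more chord: `2 + 1 = 3`.
  rcases mem_uIcc.1 hx with ⟨h1, h2⟩ | ⟨h1, h2⟩
  · have := key h1 h2 (lt_of_abs_lt hab)
    linarith [norm_nonneg (deriv p a - deriv p b)]
  · rw [abs_sub_comm] at hab
    have h3 := key h1 h2 (lt_of_abs_lt hab)
    rw [norm_sub_rev (deriv p b)] at h3
    have h4 := norm_sub_le_norm_sub_add_norm_sub (deriv p x) (deriv p b) (deriv p a)
    rw [norm_sub_rev (deriv p b)] at h4
    linarith

end IsUnitSphereParam

/-! ### Nearest-point projection onto the unit ball and lifting of paths to the arc-length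
parameter. -/

/-- `π` maps every point to the nearest point of the unit ball `{φ ≤ 1}`. -/
structure IsUnitBallProj (φ : Plane → ℝ) (π : Plane → Plane) : Prop where
  mem : ∀ x, φ (π x) ≤ 1
  inner_le : ∀ x w, φ w ≤ 1 → (inner ℝ (x - π x) (w - π x) : ℝ) ≤ 0

lemma IsAnisotropy.exists_unitBallProj {φ : Plane → ℝ} (hφ : IsAnisotropy φ) :
    ∃ π, IsUnitBallProj φ π := by
  have hne : {x | φ x ≤ 1}.Nonempty := ⟨0, by simp [hφ.map_zero]⟩
  choose π h1 h2 using
    exists_norm_eq_iInf_of_complete_convex hne hφ.isClosed_ball.isComplete hφ.convex_ball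
  refine ⟨π, h1, fun x w hw => ?_⟩
  exact (norm_eq_iInf_iff_real_inner_le_zero hφ.convex_ball (h1 x)).1 (h2 x) w hw

namespace IsUnitBallProj

variable {φ : Plane → ℝ} {π : Plane → Plane} (hπ : IsUnitBallProj φ π)
include hπ

lemma norm_sub_le (x y : Plane) : ‖π x - π y‖ ≤ ‖x - y‖ := by
  have h1 := hπ.inner_le x (π y) (hπ.mem y)
  have h2 := hπ.inner_le y (π x) (hπ.mem x)
  have h3 : ‖π x - π y‖ ^ 2 ≤ inner ℝ (x - y) (π x - π y) := by
    rw [← real_inner_self_eq_norm_sq]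
    simp only [inner_sub_left, inner_sub_right] at h1 h2 ⊢
    linarith
  have h4 := h3.trans (real_inner_le_norm _ _)
  by_contra h
  push Not at h
  have := norm_nonneg (x - y)
  nlinarith

lemma norm_sub_proj_le (x : Plane) {y : Plane} (hy : φ y ≤ 1) : ‖x - π x‖ ≤ ‖x - y‖ := by
  have h1 := hπ.inner_le x y hy
  have h2 : ‖x - y‖ ^ 2 = ‖x - π x‖ ^ 2 - 2 * inner ℝ (x - π x) (y - π x) + ‖y - π x‖ ^ 2 := by
    rw [← norm_sub_sq_real, sub_sub_sub_cancel_right]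
  have h3 : ‖x - π x‖ ^ 2 ≤ ‖x - y‖ ^ 2 := by nlinarith [sq_nonneg ‖y - π x‖]
  exact (pow_le_pow_iff_left₀ (norm_nonneg _) (norm_nonneg _) two_ne_zero).1 h3

/-- Were the projection interior, a small move towards `x` would stay in the ball and come closer to
`x`. -/
lemma proj_eq_one (hφ : IsAnisotropy φ) {x : Plane} (hx : 1 ≤ φ x) : φ (π x) = 1 := by
  refine le_antisymm (hπ.mem x) ?_
  by_contra hlt
  push Not at hlt
  set e : ℝ := (1 - φ (π x)) / (φ (x - π x) + 1) with he
  have hd : 0 < φ (x - π x) + 1 := by linarith [hφ.nonneg (x - π x)]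
  have he0 : 0 < e := div_pos (by linarith) hd
  have h1 := hπ.inner_le x (π x + e • (x - π x)) (by
    refine (hφ.add_le _ _).trans ?_
    rw [hφ.smul, abs_of_pos he0]
    have : e * (φ (x - π x) + 1) = 1 - φ (π x) := div_mul_cancel₀ _ hd.ne'
    linarith)
  rw [add_sub_cancel_left, real_inner_smul_right, real_inner_self_eq_norm_sq] at h1
  have h2 : ‖x - π x‖ = 0 := by
    by_contra h
    have : 0 < ‖x - π x‖ ^ 2 := by positivity
    nlinarith
  rw [norm_sub_eq_zero_iff] at h2
  rw [← h2] at hlt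
  linarith

end IsUnitBallProj

namespace IsUnitSphereParam

variable {φ : Plane → ℝ} {p : ℝ → Plane} (hp : IsUnitSphereParam φ p) (hφ : IsAnisotropy φ)
include hp

/-- On small scales the ratio of arc to chord tends to 1 uniformly, since the tangent is uniformly
continuous. `exists_near`, with its worse constant, serves to locate a parameter within that scale.
-/
lemma exists_short_step {κ : ℝ} (hκ : 0 < κ) : ∃ r, 0 < r ∧ ∀ a Q, φ Q = 1 → ‖Q - p a‖ < r →
    ∃ b, p b = Q ∧ |b - a| ≤ (1 + κ) * ‖Q - p a‖ := by
  obtain ⟨K, hK, hnear⟩ := hp.exists_near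
  have hκ' : 0 < κ / (1 + κ) := by positivity
  obtain ⟨d, hd, hunif⟩ := Metric.uniformContinuous_iff.1 hp.uniformContinuous_deriv _ hκ'
  refine ⟨d / K, by positivity, fun a Q hQ hQa => ?_⟩
  obtain ⟨b, hb, hba⟩ := hnear a Q hQ
  refine ⟨b, hb, ?_⟩
  have hbd : |b - a| < d := by
    rw [lt_div_iff₀ hK] at hQa
    linarith
  have hder : ∀ x, HasDerivAt (fun x => p x - x • deriv p a) (deriv p x - deriv p a) x := fun x => by
    have := (hp.hasDerivAt x).sub ((hasDerivAt_id x).smul_const (deriv p a))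
    rw [one_smul] at this
    exact this
  have h1 := Convex.norm_image_sub_le_of_norm_hasDerivWithin_le (s := uIcc a b)
    (f := fun x => p x - x • deriv p a) (C := κ / (1 + κ))
    (fun x _ => (hder x).hasDerivWithinAt) (fun x hx => by
      rw [← dist_eq_norm]
      apply (hunif _).le
      rw [Real.dist_eq]
      exact (abs_sub_left_of_mem_uIcc hx).trans_lt hbd) (convex_uIcc a b)
    left_mem_uIcc right_mem_uIcc
  simp only [hb] at h1
  have e1 : Q - b • deriv p a - (p a - a • deriv p a) = (Q - p a) - (b - a) • deriv p a := by
    rw [sub_smul]; abel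
  rw [e1, Real.norm_eq_abs, norm_sub_rev] at h1
  have h2 := norm_sub_norm_le ((b - a) • deriv p a) (Q - p a)
  rw [norm_smul, hp.speed, mul_one, Real.norm_eq_abs] at h2
  have h3 : |b - a| * (1 - κ / (1 + κ)) ≤ ‖Q - p a‖ := by linarith
  have h4 : 1 - κ / (1 + κ) = (1 + κ)⁻¹ := by field_simp; ring
  rw [h4, ← div_eq_mul_inv, div_le_iff₀ (by positivity)] at h3
  linarith

include hφ

/-- Lifting to the arc-length parameter of the nearest-point projection of a path which stays
outside the unit ball. -/
lemma exists_lift {π : Plane → Plane} (hπ : IsUnitBallProj φ π) {κ : ℝ} (hκ : 0 < κ)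
    {c : ℝ → Plane} {K : ℝ} (hK : 0 ≤ K)
    (hc : ∀ s ∈ Icc (0 : ℝ) 1, ∀ t ∈ Icc (0 : ℝ) 1, ‖c s - c t‖ ≤ K * |s - t|)
    (hφc : ∀ s ∈ Icc (0 : ℝ) 1, 1 ≤ φ (c s)) {a : ℝ} (ha : p a = π (c 0)) :
    ∃ b, p b = π (c 1) ∧ |b - a| ≤ (1 + κ) * K := by
  obtain ⟨r, hr, hstep⟩ := hp.exists_short_step hκ
  -- The path is cut into `n` pieces whose projections move by less than `r`, so that each step is a
  -- short one.
  obtain ⟨n, hn⟩ := exists_nat_gt (K / r)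
  have hn0 : (0 : ℝ) < n := lt_of_le_of_lt (by positivity) hn
  have key : ∀ k : ℕ, k ≤ n → ∃ b, p b = π (c (k / n)) ∧ |b - a| ≤ (1 + κ) * K * (k / n) := by
    intro k
    induction k with
    | zero => intro _; exact ⟨a, by simpa using ha, by simp⟩
    | succ k ih =>
      intro hk
      obtain ⟨b, hb, hba⟩ := ih (by omega)
      have hk' : ((k : ℝ) + 1) ≤ n := by exact_mod_cast hk
      have m1 : (k / n : ℝ) ∈ Icc (0 : ℝ) 1 := ⟨by positivity, (div_le_one hn0).2 (by linarith)⟩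
      have m2 : ((k + 1 : ℕ) / n : ℝ) ∈ Icc (0 : ℝ) 1 :=
        ⟨by positivity, (div_le_one hn0).2 (by push_cast; linarith)⟩
      have hd : ‖π (c ((k + 1 : ℕ) / n)) - p b‖ ≤ K * (1 / n) := by
        rw [hb]
        refine (hπ.norm_sub_le _ _).trans ((hc _ m2 _ m1).trans_eq ?_)
        congr 1
        rw [← sub_div]; push_cast
        rw [add_sub_cancel_left, abs_of_pos (by positivity)]
      have hlt : K * (1 / n) < r := by
        rw [div_lt_iff₀ hr] at hn
        rw [mul_one_div, div_lt_iff₀ hn0]; linarith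
      obtain ⟨b', hb', hbb'⟩ := hstep b _ (hπ.proj_eq_one hφ (hφc _ m2)) (hd.trans_lt hlt)
      refine ⟨b', hb', ?_⟩
      have h1 : |b' - b| ≤ (1 + κ) * (K * (1 / n)) := hbb'.trans (by gcongr)
      have h2 := abs_sub_le b' b a
      have h3 : (1 + κ) * K * ((k + 1 : ℕ) / n) = (1 + κ) * (K * (1 / n)) + (1 + κ) * K * (k / n) := by
        push_cast; field_simp; ring
      linarith
  obtain ⟨b, hb, hba⟩ := key n le_rfl
  rw [div_self hn0.ne'] at hb hba
  exact ⟨b, hb, by simpa using hba⟩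

lemma exists_lift_segment {π : Plane → Plane} (hπ : IsUnitBallProj φ π) {κ : ℝ} (hκ : 0 < κ)
    {x y : Plane} (hxy : ∀ z ∈ segment ℝ x y, 1 ≤ φ z) {a : ℝ} (ha : p a = π x) :
    ∃ b, p b = π y ∧ |b - a| ≤ (1 + κ) * ‖y - x‖ := by
  have h := hp.exists_lift hφ hπ hκ (c := fun s => x + s • (y - x)) (norm_nonneg (y - x))
    (fun s _ t _ => by
      have : x + s • (y - x) - (x + t • (y - x)) = (s - t) • (y - x) := by rw [sub_smul]; abel
      rw [this, norm_smul, Real.norm_eq_abs, mul_comm])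
    (fun s hs => hxy _ (by rw [segment_eq_image']; exact ⟨s, hs, rfl⟩)) (a := a) (by simpa using ha)
  simpa using h

/-- The form `x - π x` is maximal on the ball at `π x`, so it is parallel to the normal there;
testing with the origin gives its direction. -/
lemma sub_proj_eq {π : Plane → Plane} (hπ : IsUnitBallProj φ π) {x : Plane} {b : ℝ}
    (hb : p b = π x) : x - π x = ‖x - π x‖ • (-perp (deriv p b)) := by
  set v := x - π x with hv
  have hmax : IsLocalMax (fun y => (inner ℝ v (p y) : ℝ)) b := by
    refine Eventually.of_forall fun y => ?_
    have := hπ.inner_le x (p y) (hp.mem y).le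
    rw [inner_sub_right] at this
    simp only [hb]
    linarith
  have hd : HasDerivAt (fun y => (inner ℝ v (p y) : ℝ)) (inner ℝ v (deriv p b)) b := by
    simpa using (hasDerivAt_const b v).inner ℝ (hp.hasDerivAt b)
  have h3 := hmax.hasDerivAt_eq_zero hd
  have h4 := eq_frame (hp.speed b) v
  rw [h3, zero_smul, zero_add] at h4
  have h5 := hp.inner_perp_deriv_neg b
  have h6 := hπ.inner_le x 0 (by simp [hφ.map_zero])
  rw [← hv, zero_sub, inner_neg_right, ← hb] at h6
  set c : ℝ := inner ℝ v (perp (deriv p b))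
  have h8 : (inner ℝ v (p b) : ℝ) = c * inner ℝ (p b) (perp (deriv p b)) := by
    rw [h4, real_inner_smul_left, real_inner_comm]
  have hc : c ≤ 0 := by
    by_contra hc; push Not at hc; nlinarith
  have h7 : ‖v‖ = -c := by
    rw [h4, norm_smul, norm_perp, hp.speed, mul_one, Real.norm_eq_abs, abs_of_nonpos hc]
  rw [h7, smul_neg, neg_smul, neg_neg]
  exact h4

/-- If the unit ball lies below the line through `n` with unit normal `ν`, and almost touches it
at `n`, then its normal at the point nearest to `n + t ν` is close to `ν`. -/
lemma norm_normal_sub_le {π : Plane → Plane} (hπ : IsUnitBallProj φ π) {n ν y : Plane}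
    (hν : ‖ν‖ = 1) (hn : ∀ w, φ w ≤ 1 → (inner ℝ w ν : ℝ) ≤ inner ℝ n ν) (hy : φ y ≤ 1)
    {d t : ℝ} (hd : ‖n - y‖ ≤ d) (ht : 0 < t) {b : ℝ} (hb : p b = π (n + t • ν)) :
    ‖-perp (deriv p b) - ν‖ ^ 2 ≤ 2 * d / t := by
  set x := n + t • ν with hx
  have h1 := hp.sub_proj_eq hφ hπ hb
  have h2 : t ≤ (inner ℝ (x - π x) ν : ℝ) := by
    rw [inner_sub_left, hx, inner_add_left, real_inner_smul_left, real_inner_self_eq_norm_sq, hν]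
    have := hn (π x) (hπ.mem x)
    rw [← hx]; linarith
  have h3 : ‖x - π x‖ ≤ t + d := by
    refine (hπ.norm_sub_proj_le x hy).trans ?_
    have : x - y = (n - y) + t • ν := by rw [hx]; abel
    rw [this]
    refine (norm_add_le _ _).trans ?_
    rw [norm_smul, hν, mul_one, Real.norm_of_nonneg ht.le]; linarith
  rw [h1, real_inner_smul_left] at h2
  rw [norm_sub_sq_real, hp.norm_normal, hν]
  set q : ℝ := inner ℝ (-perp (deriv p b)) ν with hq
  have hd0 : 0 ≤ d := (norm_nonneg _).trans hd
  have hq0 : 0 < q := by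
    by_contra hneg; push Not at hneg
    nlinarith [norm_nonneg (x - π x)]
  -- `q` is the cosine of the angle between the two normals. The displacement `x - π x` has
  -- `ν`-component at least `t` and length at most `t + d`, so `q ≥ t / (t + d)`.
  have h4 : t ≤ (t + d) * q := h2.trans (by gcongr)
  have hq1 : q ≤ 1 := by
    have := real_inner_le_norm (-perp (deriv p b)) ν
    rwa [hp.norm_normal, hν, mul_one] at this
  rw [le_div_iff₀ ht]
  nlinarith

end IsUnitSphereParam

/-! ### Smooth immersed curves with a prescribed Cahn–Hoffman field. -/

/-- A regular `C¹` curve is locally a Lipschitz graph over its tangent lines. -/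
lemma isLocallyLipschitzGraph_of_contDiff {u : ℝ → Plane} (hu : ContDiff ℝ ∞ u)
    (hreg : ∀ x, deriv u x ≠ 0) : IsLocallyLipschitzGraph u := by
  intro x₀
  set e : Plane := ‖deriv u x₀‖⁻¹ • deriv u x₀ with he
  have hn := norm_pos_iff.2 (hreg x₀)
  have he1 : ‖e‖ = 1 := by rw [he, norm_smul, norm_inv, norm_norm, inv_mul_cancel₀ hn.ne']
  have hcont : Continuous (deriv u) := (contDiff_infty_iff_deriv.1 hu).2.continuous
  have hev : ∀ᶠ x in 𝓝 x₀, ‖deriv u x‖ / 2 < (inner ℝ (deriv u x) e : ℝ) := by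
    apply ContinuousAt.eventually_lt
    · exact (hcont.norm.div_const 2).continuousAt
    · exact (hcont.inner continuous_const).continuousAt
    · rw [he, real_inner_smul_right, real_inner_self_eq_norm_sq]
      have : ‖deriv u x₀‖⁻¹ * ‖deriv u x₀‖ ^ 2 = ‖deriv u x₀‖ := by field_simp
      linarith
  obtain ⟨δ, hδ, hball⟩ := Metric.eventually_nhds_iff.1 hev
  set I := Ioo (x₀ - δ) (x₀ + δ) with hI
  have hlt : ∀ x ∈ I, ‖deriv u x‖ / 2 < (inner ℝ (deriv u x) e : ℝ) := fun x hx => by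
    apply hball
    rw [Real.dist_eq, abs_lt]
    constructor <;> linarith [hx.1, hx.2]
  set h : ℝ → ℝ := fun x => inner ℝ (u x) e
  set v : ℝ → ℝ := fun x => inner ℝ (u x) (perp e)
  have hud : ∀ x, HasDerivAt u (deriv u x) x := fun x =>
    (hu.differentiable (by simp) x).hasDerivAt
  have hh : ∀ x, HasDerivAt h (inner ℝ (deriv u x) e) x := fun x => by
    simpa using (hud x).inner ℝ (hasDerivAt_const x e)
  have hv : ∀ x, HasDerivAt v (inner ℝ (deriv u x) (perp e)) x := fun x => by
    simpa using (hud x).inner ℝ (hasDerivAt_const x (perp e))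
  have hmono : StrictMonoOn h I := by
    apply strictMonoOn_of_deriv_pos (convex_Ioo _ _) fun x _ => (hh x).continuousAt.continuousWithinAt
    intro x hx
    rw [interior_Ioo] at hx
    rw [(hh x).deriv]
    linarith [hlt x hx, norm_nonneg (deriv u x)]
  have hb : ∀ x, |(inner ℝ (deriv u x) (perp e) : ℝ)| ≤ ‖deriv u x‖ := fun x => by
    have := abs_real_inner_le_norm (deriv u x) (perp e)
    rwa [norm_perp, he1, mul_one] at this
  -- Near `x₀` one has `|v'| ≤ 2 h'`; monotonicity of `2 h ± v` integrates this into Lipschitz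
  -- dependence of `v` on `h`.
  have m1 : MonotoneOn (fun x => 2 * h x + v x) I := by
    have hd := fun x => ((hh x).const_mul 2).add (hv x)
    apply monotoneOn_of_deriv_nonneg (convex_Ioo _ _)
      (fun x _ => (hd x).continuousAt.continuousWithinAt)
      (fun x _ => (hd x).differentiableAt.differentiableWithinAt)
    intro x hx
    rw [interior_Ioo] at hx
    have e1 := (hd x).deriv
    refine le_of_le_of_eq ?_ e1.symm
    linarith [hlt x hx, neg_abs_le (inner ℝ (deriv u x) (perp e) : ℝ), hb x]
  have m2 : MonotoneOn (fun x => 2 * h x - v x) I := by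
    have hd := fun x => ((hh x).const_mul 2).sub (hv x)
    apply monotoneOn_of_deriv_nonneg (convex_Ioo _ _)
      (fun x _ => (hd x).continuousAt.continuousWithinAt)
      (fun x _ => (hd x).differentiableAt.differentiableWithinAt)
    intro x hx
    rw [interior_Ioo] at hx
    have e1 := (hd x).deriv
    refine le_of_le_of_eq ?_ e1.symm
    linarith [hlt x hx, le_abs_self (inner ℝ (deriv u x) (perp e) : ℝ), hb x]
  have hlip : ∀ x ∈ I, ∀ y ∈ I, |v x - v y| ≤ 2 * |h x - h y| := by
    have key : ∀ x ∈ I, ∀ y ∈ I, y ≤ x → |v x - v y| ≤ 2 * |h x - h y| := by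
      intro x hx y hy hyx
      have a1 := m1 hy hx hyx
      have a2 := m2 hy hx hyx
      have a3 := hmono.monotoneOn hy hx hyx
      simp only at a1 a2
      rw [abs_of_nonneg (sub_nonneg.2 a3), abs_le]
      constructor <;> linarith
    intro x hx y hy
    rcases le_total y x with hyx | hxy
    · exact key x hx y hy hyx
    · rw [abs_sub_comm, abs_sub_comm (h x)]; exact key y hy x hx hxy
  have hinv : ∀ x ∈ I, Function.invFunOn h I (h x) = x := fun x hx =>
    hmono.injOn.leftInvOn_invFunOn hx
  have hL : LipschitzOnWith 2 (fun z => v (Function.invFunOn h I z)) (h '' I) := by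
    apply LipschitzOnWith.of_dist_le_mul
    rintro _ ⟨x, hx, rfl⟩ _ ⟨y, hy, rfl⟩
    simp only [hinv x hx, hinv y hy, Real.dist_eq]
    exact hlip x hx y hy
  obtain ⟨F, hF, hFe⟩ := hL.extend_real
  refine ⟨δ, e, F, 2, hδ, he1, hF, hmono.injOn, fun x hx => ?_⟩
  have h1 := hFe (mem_image_of_mem h hx)
  simp only [hinv x hx] at h1
  exact h1

/-- A smooth immersed curve with a smooth Cahn-Hoffman field has anisotropic curvature bounded by
the speed of the field. -/
lemma isPhiRegular_and_curvature_le {φ : Plane → ℝ} (hφ : IsAnisotropy φ) (hell : IsElliptic φ)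
    {u n : ℝ → Plane} (hu : ContDiff ℝ ∞ u) (hn : ContDiff ℝ ∞ n)
    (hreg : ∀ x, deriv u x ≠ 0) (hper : Function.Periodic u (2 * Real.pi))
    (hnper : Function.Periodic n (2 * Real.pi))
    (hmem : ∀ x, n x ∈ subdifferential (polar φ) (perp (‖deriv u x‖⁻¹ • deriv u x)))
    {C : ℝ} (hC : ∀ x, ‖deriv n x‖ ≤ C * ‖deriv u x‖) :
    IsPhiRegular φ u ∧ ∃ κ : ℝ → ℝ, IsAnisotropicCurvature φ u κ ∧ ∀ᵐ s : ℝ, |κ s| ≤ C := by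
  obtain ⟨f, g, L, hL, hfs, hgs, hf0, hfm, hfd, hfT, hgT, hgf, hfg, hgd, hγd⟩ :=
    exists_arcLength_inverse hu hreg Real.two_pi_pos hper
  set γ : ℝ → Plane := fun y => u (g y) with hγ
  set N : ℝ → Plane := fun y => n (g y) with hN
  have htan : ∀ y, tangent γ y = ‖deriv u (g y)‖⁻¹ • deriv u (g y) := fun y => (hγd y).deriv
  have hpos : ∀ y, 0 < ‖deriv u y‖ := fun y => norm_pos_iff.2 (hreg y)
  have hunit : ∀ y, ‖tangent γ y‖ = 1 := fun y => by
    rw [htan, norm_smul, norm_inv, norm_norm, inv_mul_cancel₀ (hpos _).ne']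
  have hNd : ∀ y, HasDerivAt N (‖deriv u (g y)‖⁻¹ • deriv n (g y)) y := fun y =>
    ((hn.differentiable (by simp) (g y)).hasDerivAt).scomp y (hgd y)
  have hNC : ∀ y, ‖deriv N y‖ ≤ C := fun y => by
    rw [(hNd y).deriv, norm_smul, norm_inv, norm_norm, ← div_eq_inv_mul, div_le_iff₀ (hpos _)]
    exact hC _
  have hC0 : 0 ≤ C := (norm_nonneg _).trans (hNC 0)
  have hnormal : ∀ y, normal γ y ≠ 0 := fun y h => by
    have h1 := norm_perp (tangent γ y)
    rw [hunit, show perp (tangent γ y) = 0 from h, norm_zero] at h1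
    exact zero_ne_one h1
  have hγN : ∀ y, N y ∈ subdifferential (polar φ) (normal γ y) := fun y => by
    have := hmem (g y)
    rwa [← htan] at this
  have harc : IsArcLengthParam u γ L := by
    refine ⟨hL, fun y => by simp only [hγ, hgT]; exact hper _, ?_, ?_, f, hfs.continuous, hfm,
      hf0, hfT, fun x => by simp only [hγ, hgf]⟩
    · refine lipschitzWith_of_nnnorm_deriv_le (fun y => (hγd y).differentiableAt) fun y => ?_
      have := hunit y
      rw [← NNReal.coe_le_coe]
      exact this.le
    · exact Eventually.of_forall hunit
  have hCH : IsCahnHoffman φ γ L N := by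
    refine ⟨fun y => by simp only [hN, hgT]; exact hnper _, ⟨C.toNNReal, ?_⟩,
      Eventually.of_forall hγN⟩
    refine lipschitzWith_of_nnnorm_deriv_le (fun y => (hNd y).differentiableAt) fun y => ?_
    rw [← NNReal.coe_le_coe, Real.coe_toNNReal _ hC0]
    exact hNC y
  refine ⟨⟨isLocallyLipschitzGraph_of_contDiff hu hreg, γ, L, harc, N, hCH⟩,
    fun s => -inner ℝ (deriv N s) (tangent γ s), ⟨γ, L, N, harc, ⟨hCH, ?_⟩,
      Eventually.of_forall fun _ => rfl⟩, Eventually.of_forall fun s => ?_⟩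
  -- Ellipticity leaves one Cahn–Hoffman vector for each normal, so there is a single competitor and
  -- minimality is automatic.
  · intro m hm
    obtain ⟨K, hK⟩ := hm.lipschitz
    obtain ⟨K', hK'⟩ := hCH.lipschitz
    have : m = N := by
      refine hK.continuous.ae_eq_iff_eq volume hK'.continuous |>.1 ?_
      filter_upwards [hm.mem] with s hs
      exact hφ.subdifferential_subsingleton hell (hnormal s) hs (hγN s)
    rw [this]
  · rw [abs_neg]
    refine (abs_real_inner_le_norm _ _).trans ?_
    rw [hunit, mul_one]
    exact hNC s

/-- A regular reparametrization of a curve which moves against the unit sphere of `φ`. -/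
lemma IsUnitSphereParam.isPhiRegular_and_curvature_le {φ : Plane → ℝ} {p : ℝ → Plane}
    (hp : IsUnitSphereParam φ p) (hφ : IsAnisotropy φ) (hell : IsElliptic φ) {u : ℝ → Plane}
    {l w : ℝ → ℝ} (hu : ContDiff ℝ ∞ u) (hl : ContDiff ℝ ∞ l)
    (hper : Function.Periodic u (2 * Real.pi))
    (hlper : Function.Periodic (fun x => p (l x)) (2 * Real.pi)) (hw : ∀ x, 0 < w x)
    (hderiv : ∀ x, deriv u x = -(w x • deriv p (l x))) {C : ℝ} (hC : ∀ x, |deriv l x| ≤ C * w x) :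
    (∀ x, deriv u x ≠ 0) ∧
    IsPhiRegular φ u ∧ ∃ κ : ℝ → ℝ, IsAnisotropicCurvature φ u κ ∧ ∀ᵐ s : ℝ, |κ s| ≤ C := by
  have hnorm : ∀ x, ‖deriv u x‖ = w x := fun x => by
    rw [hderiv, norm_neg, norm_smul, hp.speed, mul_one, Real.norm_of_nonneg (hw x).le]
  have hreg : ∀ x, deriv u x ≠ 0 := fun x => norm_pos_iff.1 (by rw [hnorm]; exact hw x)
  refine ⟨hreg, _root_.isPhiRegular_and_curvature_le hφ hell (n := fun x => p (l x)) hu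
    (hp.smooth.comp hl) hreg hper hlper (fun x => ?_) fun x => ?_⟩
  · rw [hnorm, hderiv, smul_neg, inv_smul_smul₀ (hw x).ne', perp_neg]
    exact hp.mem_subdifferential hφ (l x)
  · have h1 : HasDerivAt (fun x => p (l x)) (deriv l x • deriv p (l x)) x :=
      (hp.hasDerivAt (l x)).scomp x (hl.differentiable (by simp) x).hasDerivAt
    rw [h1.deriv, norm_smul, hp.speed, mul_one, hnorm, Real.norm_eq_abs]
    exact hC x

/-- Every smooth elliptic anisotropy has a smooth closed curve of small curvature. -/
lemma IsAnisotropy.exists_curve_curvature_le {φ : Plane → ℝ} (hφ : IsAnisotropy φ)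
    (hs : ContDiffOn ℝ ∞ φ {0}ᶜ) (hell : IsElliptic φ) {C : ℝ} (hC : 0 < C) :
    ∃ u : ℝ → Plane, Function.Periodic u (2 * Real.pi) ∧ ContDiff ℝ ∞ u ∧
      (∀ x, deriv u x ≠ 0) ∧ IsPhiRegular φ u ∧
      ∃ κ : ℝ → ℝ, IsAnisotropicCurvature φ u κ ∧ ∀ᵐ s : ℝ, |κ s| ≤ C := by
  obtain ⟨p, hp⟩ := hφ.exists_unitSphereParam hs
  obtain ⟨c, hc, hper⟩ := hp.exists_period
  have hpi := Real.pi_pos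
  set b : ℝ := c / (2 * Real.pi) with hb
  have hb0 : 0 < b := by positivity
  have hl : ∀ x, HasDerivAt (fun x => b * x) b x := fun x => by
    simpa using (hasDerivAt_id x).const_mul b
  have hpl : ∀ x, HasDerivAt (fun x => p (b * x)) (b • deriv p (b * x)) x := fun x =>
    (hp.hasDerivAt (b * x)).scomp x (hl x)
  have hlper : Function.Periodic (fun x => p (b * x)) (2 * Real.pi) := fun x => by
    have : b * (x + 2 * Real.pi) = b * x + c := by rw [hb]; field_simp
    simp only [this]; exact hper _
  have hls : ContDiff ℝ ∞ (fun x : ℝ => b * x) := contDiff_const.mul contDiff_id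
  -- The unit sphere dilated by `1 / C`, whose field moves `C` times as fast as the curve. The sign
  -- makes the velocity a positive multiple of `-p'`.
  have hus : ContDiff ℝ ∞ (fun x => -(C⁻¹ • p (b * x))) :=
    ((hp.smooth.comp hls).const_smul C⁻¹).neg
  have huper : Function.Periodic (fun x => -(C⁻¹ • p (b * x))) (2 * Real.pi) := fun x => by
    simp only; rw [show p (b * (x + 2 * Real.pi)) = p (b * x) from hlper x]
  refine ⟨_, huper, hus, hp.isPhiRegular_and_curvature_le hφ hell (l := fun x => b * x)
    (w := fun _ => C⁻¹ * b) hus hls huper hlper (fun x => by positivity) (fun x => ?_) fun x => ?_⟩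
  · refine ((hpl x).const_smul C⁻¹).neg.deriv.trans ?_
    rw [smul_smul]
  · rw [(hl x).deriv, abs_of_pos hb0, mul_inv_cancel_left₀ hC.ne']

/-! ### Mollification, and calculus of Lipschitz curves. -/

/-- Smoothing of a function on the line which is periodic up to a constant. Every bound for the
increments of the function over a fixed distance is inherited by the smooth function. -/
lemma exists_smooth_approx {f : ℝ → ℝ} (hf : Continuous f) {p c : ℝ} (hp : 0 < p)
    (hper : ∀ x, f (x + p) = f x + c) {δ : ℝ} (hδ : 0 < δ) :
    ∃ g : ℝ → ℝ, ContDiff ℝ ∞ g ∧ (∀ x, |g x - f x| ≤ δ) ∧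
      ∀ r m, (∀ x, f (x + r) ≤ f x + m) → ∀ x, g (x + r) ≤ g x + m := by
  have hu : UniformContinuous f := by
    have h1 : Function.Periodic (fun x => f x - c / p * x) p := fun x => by
      simp only [hper]; field_simp; ring
    have h2 := h1.uniformContinuous_of_continuous hp
      (hf.sub (continuous_const.mul continuous_id))
    have h3 : UniformContinuous fun x : ℝ => c / p * x := (LipschitzWith.of_dist_le_mul (K := ‖c / p‖₊) fun x y => by
      rw [Real.dist_eq, Real.dist_eq, ← mul_sub, abs_mul]; rfl).uniformContinuous
    simpa using h2.add h3
  obtain ⟨d, hd, hunif⟩ := Metric.uniformContinuous_iff.1 hu δ hδ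
  let b : ContDiffBump (0 : ℝ) := ⟨d / 2, d, by positivity, by linarith⟩
  set k : ℝ → ℝ := b.normed volume with hk
  have hkc : HasCompactSupport k := b.hasCompactSupport_normed
  have hkcont : Continuous k := b.continuous_normed
  set g : ℝ → ℝ := fun x => ∫ t, k t * f (x - t) with hg
  have hgconv : g = convolution k f (ContinuousLinearMap.lsmul ℝ ℝ) volume := by
    ext x; simp [hg, convolution_def]
  have hint : ∀ x, Integrable fun t => k t * f (x - t) := fun x =>
    (hkcont.mul (hf.comp (continuous_const.sub continuous_id))).integrable_of_hasCompactSupport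
      hkc.mul_right
  refine ⟨g, ?_, fun x => ?_, fun r m h x => ?_⟩
  · rw [hgconv]
    exact hkc.contDiff_convolution_left _ b.contDiff_normed hf.locallyIntegrable
  · rw [hgconv, ← Real.dist_eq]
    exact ContDiffBump.dist_normed_convolution_le hf.aestronglyMeasurable
      fun y hy => (hunif hy).le
  -- The kernel is nonnegative with integral one, so an inequality between translates survives
  -- averaging.
  · have h1 : g x + m = ∫ t, (k t * f (x - t) + k t * m) := by
      rw [integral_add (hint x) (b.integrable_normed.mul_const m), integral_mul_const, hk,
        b.integral_normed, one_mul]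
    rw [h1]
    refine integral_mono (hint _) ((hint x).add (b.integrable_normed.mul_const m)) fun t => ?_
    simp only
    rw [← mul_add]
    refine mul_le_mul_of_nonneg_left ?_ (b.nonneg_normed t)
    have := h (x - t)
    rwa [show x + r - t = x - t + r by ring]

section Lipschitz

variable {f : ℝ → Plane} {K : NNReal}

lemma LipschitzWith.intervalIntegrable_deriv (hf : LipschitzWith K f) (a b : ℝ) :
    IntervalIntegrable (deriv f) volume a b := by
  refine IntervalIntegrable.mono_fun' (g := fun _ => (K : ℝ)) intervalIntegrable_const
    (stronglyMeasurable_deriv f).aestronglyMeasurable ?_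
  exact Eventually.of_forall fun x => norm_deriv_le_of_lipschitz hf

/-- Testing against a fixed vector reduces this to absolutely continuous scalar functions. -/
lemma LipschitzWith.integral_deriv_eq_sub (hf : LipschitzWith K f) (a b : ℝ) :
    ∫ x in a..b, deriv f x = f b - f a := by
  refine ext_inner_left ℝ fun v => ?_
  have h1 : LipschitzWith (‖innerSL ℝ v‖₊ * K) (fun x => (inner ℝ v (f x) : ℝ)) :=
    (innerSL ℝ v).lipschitz.comp hf
  have h2 := (h1.lipschitzOnWith (s := uIcc a b)).absolutelyContinuousOnInterval.integral_deriv_eq_sub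
  have h3 := (innerSL ℝ v).intervalIntegral_comp_comm (hf.intervalIntegrable_deriv a b)
  rw [innerSL_apply_apply] at h3
  rw [← h3, inner_sub_right, ← h2]
  refine intervalIntegral.integral_congr_ae ?_
  filter_upwards [hf.ae_differentiableAt_real] with x hx _
  rw [innerSL_apply_apply]
  exact (((innerSL ℝ v).hasFDerivAt (x := f x)).comp_hasDerivAt x hx.hasDerivAt).deriv.symm

lemma LipschitzWith.norm_sub_le_of_ae_norm_deriv_le (hf : LipschitzWith K f) {C : ℝ}
    (hC : ∀ᵐ x, ‖deriv f x‖ ≤ C) (a b : ℝ) : ‖f b - f a‖ ≤ C * |b - a| := by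
  rw [← hf.integral_deriv_eq_sub]
  exact intervalIntegral.norm_integral_le_of_norm_le_const_ae (hC.mono fun x hx _ => hx)

end Lipschitz

/-! ### The field along the given curve, and nondegeneracy of its tangent. -/

/-- The data of a closed curve with a Cahn-Hoffman field of speed at most `C`. -/
structure IsCahnHoffmanCurve (φ : Plane → ℝ) (γ N : ℝ → Plane) (L C : ℝ) : Prop where
  pos : 0 < L
  lipschitz : LipschitzWith 1 γ
  periodic : Function.Periodic γ L
  field_periodic : Function.Periodic N L
  field_mem : ∀ s, φ (N s) = 1
  field_lipschitz : ∀ s t, ‖N s - N t‖ ≤ C * |s - t|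
  good : ∀ᵐ s : ℝ, ‖tangent γ s‖ = 1 ∧ N s ∈ subdifferential (polar φ) (normal γ s)

lemma ae_eq_const_everywhere {f : ℝ → ℝ} (hf : Continuous f) {c : ℝ} (h : ∀ᵐ s, f s = c) (s : ℝ) :
    f s = c :=
  congrFun ((hf.ae_eq_iff_eq volume (g := fun _ => c) continuous_const).1 h) s

/-- All values of `N` lie in the unit ball, so `N x · ν(s)` is maximal at `x = s` and the derivative
of `N` is tangential a.e. A bound for the tangential component is thus a bound for the full speed.
-/
lemma IsCahnHoffman.isCahnHoffmanCurve {φ : Plane → ℝ} (hφ : IsAnisotropy φ) {u γ N : ℝ → Plane}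
    {L C : ℝ} (hγ : IsArcLengthParam u γ L) (hN : IsCahnHoffman φ γ L N)
    (hC : ∀ᵐ s : ℝ, |(inner ℝ (deriv N s) (tangent γ s) : ℝ)| ≤ C) :
    IsCahnHoffmanCurve φ γ N L C := by
  obtain ⟨K, hK⟩ := hN.lipschitz
  have hgood : ∀ᵐ s : ℝ, ‖tangent γ s‖ = 1 ∧ N s ∈ subdifferential (polar φ) (normal γ s) :=
    hγ.unit_speed.and hN.mem
  have hne : ∀ {s}, ‖tangent γ s‖ = 1 → normal γ s ≠ 0 := fun {s} h h0 => by
    have h1 := norm_perp (tangent γ s)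
    rw [h, show perp (tangent γ s) = 0 from h0, norm_zero] at h1
    exact zero_ne_one h1
  have hmem : ∀ s, φ (N s) = 1 := by
    refine ae_eq_const_everywhere (hφ.continuous.comp hK.continuous) ?_
    filter_upwards [hgood] with s hs
    exact hφ.eq_one_of_mem_subdifferential (hne hs.1) hs.2
  refine ⟨hγ.pos, hγ.lipschitz, hγ.periodic, hN.periodic, hmem, fun s t => ?_, hgood⟩
  · refine hK.norm_sub_le_of_ae_norm_deriv_le ?_ t s
    filter_upwards [hgood, hC, hK.ae_differentiableAt_real] with s hs hCs hd
    have hmax : IsLocalMax (fun x => (inner ℝ (N x) (normal γ s) : ℝ)) s := by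
      refine Eventually.of_forall fun x => ?_
      simp only
      rw [hφ.inner_eq_of_mem_subdifferential hs.2]
      exact hφ.inner_le_polar (hmem x).le _
    have hder : HasDerivAt (fun x => (inner ℝ (N x) (normal γ s) : ℝ))
        (inner ℝ (deriv N s) (normal γ s)) s := by
      simpa using hd.hasDerivAt.inner ℝ (hasDerivAt_const s (normal γ s))
    have h0 := hmax.hasDerivAt_eq_zero hder
    have h1 := norm_sq_frame hs.1 (deriv N s)
    rw [show perp (tangent γ s) = normal γ s from rfl, h0] at h1
    have h2 : ‖deriv N s‖ = |(inner ℝ (deriv N s) (tangent γ s) : ℝ)| := by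
      rw [← Real.sqrt_sq (norm_nonneg (deriv N s)), h1, zero_pow two_ne_zero, add_zero,
        Real.sqrt_sq_eq_abs]
    rw [h2]; exact hCs

lemma intervalIntegrable_of_bound {E : Type*} [NormedAddCommGroup E] {f : ℝ → E}
    (hf : StronglyMeasurable f) {B : ℝ} (hB : ∀ x, ‖f x‖ ≤ B) (a b : ℝ) :
    IntervalIntegrable f volume a b :=
  IntervalIntegrable.mono_fun' (g := fun _ => B) intervalIntegrable_const
    hf.aestronglyMeasurable (Eventually.of_forall hB)

lemma stronglyMeasurable_inner_tangent (γ : ℝ → Plane) (a : Plane) :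
    StronglyMeasurable fun s => (inner ℝ a (tangent γ s) : ℝ) :=
  stronglyMeasurable_const.inner (stronglyMeasurable_deriv γ)

namespace IsCahnHoffmanCurve

variable {φ : Plane → ℝ} {γ N : ℝ → Plane} {L C : ℝ} (h : IsCahnHoffmanCurve φ γ N L C)
include h

lemma norm_tangent_le (s : ℝ) : ‖tangent γ s‖ ≤ 1 := norm_deriv_le_of_lipschitz h.lipschitz

lemma tangent_periodic : Function.Periodic (tangent γ) L := h.periodic.deriv_periodic

lemma field_continuous : Continuous N := by
  have : LipschitzWith C.toNNReal N := by
    apply LipschitzWith.of_dist_le_mul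
    intro s t
    rw [dist_eq_norm, Real.dist_eq]
    exact (h.field_lipschitz s t).trans
      (mul_le_mul_of_nonneg_right (Real.le_coe_toNNReal C) (abs_nonneg _))
  exact this.continuous

lemma abs_inner_le (a : Plane) (s : ℝ) : |(inner ℝ a (tangent γ s) : ℝ)| ≤ ‖a‖ := by
  have := abs_real_inner_le_norm a (tangent γ s)
  nlinarith [norm_nonneg a, h.norm_tangent_le s]

lemma intervalIntegrable_inner_mul (a b : Plane) (x y : ℝ) : IntervalIntegrable
    (fun s => (inner ℝ a (tangent γ s) * inner ℝ b (tangent γ s) : ℝ)) volume x y := by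
  refine intervalIntegrable_of_bound (B := ‖a‖ * ‖b‖)
    ((stronglyMeasurable_inner_tangent γ a).mul (stronglyMeasurable_inner_tangent γ b)) (fun s => ?_) x y
  rw [Pi.mul_apply, norm_mul]
  exact mul_le_mul (h.abs_inner_le a s) (h.abs_inner_le b s) (norm_nonneg _) (norm_nonneg _)

lemma intervalIntegrable_inner_sq (a : Plane) (x y : ℝ) :
    IntervalIntegrable (fun s => (inner ℝ a (tangent γ s) : ℝ) ^ 2) volume x y := by
  simpa only [sq] using h.intervalIntegrable_inner_mul a a x y

/-- The tangent of a closed curve with a Cahn-Hoffman field takes more than one direction. -/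
lemma integral_inner_sq_pos (hφ : IsAnisotropy φ) {a : Plane} (ha : ‖a‖ = 1) :
    0 < ∫ s in (0 : ℝ)..L, (inner ℝ a (tangent γ s) : ℝ) ^ 2 := by
  refine lt_of_le_of_ne (intervalIntegral.integral_nonneg h.pos.le fun s _ => sq_nonneg _) ?_
  intro h0
  have h1 := (intervalIntegral.integral_eq_zero_iff_of_le_of_nonneg_ae h.pos.le
    (Eventually.of_forall fun s => sq_nonneg _) (h.intervalIntegrable_inner_sq a 0 L)).1 h0.symm
  have ha0 : a ≠ 0 := by rintro rfl; simp at ha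
  set P := polar φ a with hP
  have hPpos : 0 < P := hφ.polar_pos ha0
  set e : ℝ → ℝ := fun s => inner ℝ (tangent γ s) (perp a) with he
  -- If the integral vanished, the tangent would be `± perp a` a.e., and the Cahn–Hoffman condition
  -- would give `N · a = ∓ P`. Continuity of `N` fixes the sign, so the curve would run in one
  -- direction and never close.
  have h2 : ∀ᵐ s ∂volume.restrict (Ioc 0 L), (inner ℝ (N s) a : ℝ) = -e s * P ∧ e s ^ 2 = 1 := by
    filter_upwards [h1, ae_restrict_of_ae h.good] with s hs hg
    have hs' : (inner ℝ (tangent γ s) a : ℝ) = 0 := by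
      rw [real_inner_comm]; simpa using hs
    have f1 := eq_frame ha (tangent γ s)
    have f2 := norm_sq_frame ha (tangent γ s)
    rw [hs', zero_smul, zero_add] at f1
    rw [hs', hg.1] at f2
    have f3 : e s ^ 2 = 1 := by simp only [he]; linarith
    have f4 : normal γ s = -e s • a := by
      rw [normal, f1, perp_smul, perp_perp, smul_neg, neg_smul]
    have f5 := hφ.inner_eq_of_mem_subdifferential hg.2
    rw [f4, real_inner_smul_right] at f5
    have f6 : polar φ (-e s • a) = P := by
      rcases sq_eq_one_iff.1 f3 with f | f
      · rw [f, neg_one_smul, hφ.polar_neg]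
      · rw [f, neg_neg, one_smul]
    rw [f6] at f5
    refine ⟨?_, f3⟩
    linear_combination (-e s) * f5 - (inner ℝ (N s) a) * f3
  have hNa : Continuous fun s => (inner ℝ (N s) a : ℝ) := h.field_continuous.inner continuous_const
  have h3 : EqOn ((fun s => (inner ℝ (N s) a : ℝ)) ^ 2) ((fun _ => P) ^ 2) (Ioo 0 L) := by
    refine Measure.eqOn_open_of_ae_eq (μ := volume) ?_ isOpen_Ioo (hNa.pow 2).continuousOn
      (continuous_const.pow 2).continuousOn
    refine ae_restrict_of_ae_restrict_of_subset Ioo_subset_Ioc_self ?_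
    filter_upwards [h2] with s hs
    simp only [Pi.pow_apply, hs.1]
    linear_combination P ^ 2 * hs.2
  have h4 : ∃ σ : ℝ, σ ≠ 0 ∧ ∀ s ∈ Ioo 0 L, (inner ℝ (N s) a : ℝ) = σ * P := by
    rcases isPreconnected_Ioo.eq_or_eq_neg_of_sq_eq hNa.continuousOn continuousOn_const h3
      (fun _ => hPpos.ne') with h5 | h5
    · exact ⟨1, one_ne_zero, fun s hs => by simpa using h5 hs⟩
    · exact ⟨-1, by norm_num, fun s hs => by simpa using h5 hs⟩
  obtain ⟨σ, hσ, h5⟩ := h4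
  have h6 : ∫ s in (0 : ℝ)..L, e s = ∫ s in (0 : ℝ)..L, -σ := by
    refine intervalIntegral.integral_congr_ae ?_
    rw [uIoc_of_le h.pos.le]
    have hne : ∀ᵐ s : ℝ, s ≠ L := by simp [ae_iff, measure_singleton]
    filter_upwards [(ae_restrict_iff' measurableSet_Ioc).1 h2, hne] with s hs hsL hsI
    have := h5 s ⟨hsI.1, lt_of_le_of_ne hsI.2 hsL⟩
    rw [(hs hsI).1] at this
    have := mul_right_cancel₀ hPpos.ne' this
    linarith
  have h7 : ∫ s in (0 : ℝ)..L, e s = 0 := by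
    have h8 := (innerSL ℝ (perp a)).intervalIntegral_comp_comm
      (h.lipschitz.intervalIntegrable_deriv 0 L)
    rw [h.lipschitz.integral_deriv_eq_sub] at h8
    have h9 : γ L = γ 0 := by simpa using h.periodic 0
    rw [h9, sub_self, map_zero] at h8
    refine Eq.trans ?_ h8
    refine intervalIntegral.integral_congr fun s _ => ?_
    simp only [he, innerSL_apply_apply]
    rw [real_inner_comm]; rfl
  rw [h7, intervalIntegral.integral_const, sub_zero, smul_eq_mul] at h6
  have := mul_ne_zero h.pos.ne' (neg_ne_zero.2 hσ)
  exact this h6.symm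

/-- Compactness of the unit circle makes the positivity uniform; this coercivity survives small
perturbations of the tangent. -/
lemma exists_integral_inner_sq_ge (hφ : IsAnisotropy φ) : ∃ c, 0 < c ∧ ∀ a : Plane,
    c * ‖a‖ ^ 2 ≤ ∫ s in (0 : ℝ)..L, (inner ℝ a (tangent γ s) : ℝ) ^ 2 := by
  set q : Plane → ℝ := fun a => ∫ s in (0 : ℝ)..L, (inner ℝ a (tangent γ s) : ℝ) ^ 2 with hq
  have hqsmul : ∀ (r : ℝ) a, q (r • a) = r ^ 2 * q a := fun r a => by
    simp only [hq, real_inner_smul_left, mul_pow, intervalIntegral.integral_const_mul]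
  set b₀ : Plane := !₂[1, 0]
  set b₁ : Plane := !₂[0, 1]
  have hqcont : Continuous q := by
    have : q = fun a => a 0 ^ 2 * q b₀ + 2 * (a 0 * a 1) *
        (∫ s in (0 : ℝ)..L, (inner ℝ b₀ (tangent γ s) * inner ℝ b₁ (tangent γ s) : ℝ))
        + a 1 ^ 2 * q b₁ := by
      ext a
      simp only [hq]
      rw [← intervalIntegral.integral_const_mul, ← intervalIntegral.integral_const_mul,
        ← intervalIntegral.integral_const_mul, ← intervalIntegral.integral_add,
        ← intervalIntegral.integral_add]
      · refine intervalIntegral.integral_congr fun s _ => ?_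
        simp [Plane.inner_eq, b₀, b₁]; ring
      · exact ((h.intervalIntegrable_inner_sq _ 0 L).const_mul _).add
          ((h.intervalIntegrable_inner_mul _ _ 0 L).const_mul _)
      · exact (h.intervalIntegrable_inner_sq _ 0 L).const_mul _
      · exact (h.intervalIntegrable_inner_sq _ 0 L).const_mul _
      · exact (h.intervalIntegrable_inner_mul _ _ 0 L).const_mul _
    rw [this]
    fun_prop
  have hne : (Metric.sphere (0 : Plane) 1).Nonempty := NormedSpace.sphere_nonempty.2 zero_le_one
  obtain ⟨z, hz, hmin⟩ := (isCompact_sphere (0 : Plane) 1).exists_isMinOn hne hqcont.continuousOn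
  have hz1 : ‖z‖ = 1 := by simpa using hz
  refine ⟨q z, h.integral_inner_sq_pos hφ hz1, fun a => ?_⟩
  by_cases ha : a = 0
  · simp [ha]
  have han : 0 < ‖a‖ := norm_pos_iff.2 ha
  have h1 : q z ≤ q (‖a‖⁻¹ • a) := hmin (by simp [norm_smul, han.ne'])
  rw [hqsmul] at h1
  calc q z * ‖a‖ ^ 2 ≤ (‖a‖⁻¹) ^ 2 * q a * ‖a‖ ^ 2 := by gcongr
    _ = q a := by field_simp

end IsCahnHoffmanCurve

/-! ### Interpolation and sampling on uniform grids. -/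

/-- Piecewise linear interpolation on a uniform grid, periodic up to a constant. -/
lemma exists_piecewise_linear {Λ : ℤ → ℝ} {m : ℕ} {c K h : ℝ} (hh : 0 < h)
    (hper : ∀ j, Λ (j + m) = Λ j + c) (hK : ∀ j, |Λ (j + 1) - Λ j| ≤ K * h) (t₀ : ℝ) :
    ∃ l : ℝ → ℝ, (∀ x y, |l x - l y| ≤ K * |x - y|) ∧ (∀ x, l (x + m * h) = l x + c) ∧
      ∀ (j : ℤ) (s : ℝ), t₀ + j * h ≤ s → s < t₀ + (j + 1) * h → l s ∈ uIcc (Λ j) (Λ (j + 1)) := by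
  set F : ℝ → ℝ := fun y => Λ ⌊y⌋ + Int.fract y * (Λ (⌊y⌋ + 1) - Λ ⌊y⌋) with hF
  have hint : ∀ (n : ℕ) (i : ℤ), |Λ (i + n) - Λ i| ≤ K * h * n := by
    intro n
    induction n with
    | zero => simp
    | succ n ih =>
      intro i
      have h1 := abs_sub_le (Λ (i + (n + 1 : ℕ))) (Λ (i + n)) (Λ i)
      have h2 := hK (i + n)
      rw [show i + n + 1 = i + ((n + 1 : ℕ) : ℤ) by push_cast; ring] at h2
      push_cast at h1 h2 ⊢
      linarith [ih i]
  have hlip : ∀ x y, y ≤ x → |F x - F y| ≤ K * h * (x - y) := by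
    intro x y hyx
    have hfl : ⌊y⌋ ≤ ⌊x⌋ := Int.floor_le_floor hyx
    have fx := Int.floor_add_fract x
    have fy := Int.floor_add_fract y
    have px := Int.fract_nonneg x
    have py := Int.fract_nonneg y
    have qy := Int.fract_lt_one y
    rcases hfl.eq_or_lt with h1 | h1
    · have : F x - F y = (x - y) * (Λ (⌊x⌋ + 1) - Λ ⌊x⌋) := by
        have : x - y = Int.fract x - Int.fract y := by
          have h1R : (⌊y⌋ : ℝ) = ⌊x⌋ := by rw [h1]
          linarith
        simp only [hF, h1, this]; ring
      rw [this, abs_mul, abs_of_nonneg (sub_nonneg.2 hyx), mul_comm]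
      exact mul_le_mul_of_nonneg_right (hK _) (sub_nonneg.2 hyx)
    -- Between different cells the increment splits into the rest of the first cell, `n` full cells
    -- and the start of the last one.
    · obtain ⟨n, hn⟩ := Int.eq_ofNat_of_zero_le (show 0 ≤ ⌊x⌋ - (⌊y⌋ + 1) by omega)
      have hn' : ⌊x⌋ = ⌊y⌋ + 1 + n := by omega
      have hnR : (⌊x⌋ : ℝ) = ⌊y⌋ + 1 + n := by rw [hn']; push_cast; ring
      have e : F x - F y = Int.fract x * (Λ (⌊x⌋ + 1) - Λ ⌊x⌋)
          + (Λ (⌊y⌋ + 1 + n) - Λ (⌊y⌋ + 1))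
          + (1 - Int.fract y) * (Λ (⌊y⌋ + 1) - Λ ⌊y⌋) := by
        simp only [hF]; rw [← hn']; ring
      rw [e]
      refine (abs_add_three _ _ _).trans ?_
      rw [abs_mul, abs_mul, abs_of_nonneg px, abs_of_nonneg (by linarith : 0 ≤ 1 - Int.fract y)]
      have b1 := mul_le_mul_of_nonneg_left (hK ⌊x⌋) px
      have b2 := hint n (⌊y⌋ + 1)
      have b3 := mul_le_mul_of_nonneg_left (hK ⌊y⌋) (by linarith : 0 ≤ 1 - Int.fract y)
      have e2 : x - y = Int.fract x + n + (1 - Int.fract y) := by linarith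
      rw [e2]
      linarith
  have hlip' : ∀ x y, |F x - F y| ≤ K * h * |x - y| := by
    intro x y
    rcases le_total y x with hyx | hxy
    · rw [abs_of_nonneg (sub_nonneg.2 hyx)]; exact hlip x y hyx
    · rw [abs_sub_comm, abs_sub_comm x, abs_of_nonneg (sub_nonneg.2 hxy)]; exact hlip y x hxy
  refine ⟨fun s => F ((s - t₀) / h), fun x y => ?_, fun x => ?_, fun j s h1 h2 => ?_⟩
  · refine (hlip' _ _).trans_eq ?_
    rw [← sub_div, sub_sub_sub_cancel_right, abs_div, abs_of_pos hh]
    field_simp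
  · have e : (x + m * h - t₀) / h = (x - t₀) / h + (m : ℤ) := by push_cast; field_simp; ring
    simp only [hF, e, Int.floor_add_intCast, Int.fract_add_intCast, hper]
    rw [show ⌊(x - t₀) / h⌋ + (m : ℤ) + 1 = ⌊(x - t₀) / h⌋ + 1 + m by ring, hper]
    ring
  · have hfl : ⌊(s - t₀) / h⌋ = j := by
      rw [Int.floor_eq_iff, le_div_iff₀ hh, div_lt_iff₀ hh]
      constructor <;> linarith
    simp only [hF, hfl]
    rw [← segment_eq_uIcc, segment_eq_image']
    exact ⟨_, ⟨Int.fract_nonneg _, (Int.fract_lt_one _).le⟩, rfl⟩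

/-- A sequence whose increments repeat with period `m`, extended to all integers. -/
lemma exists_int_extension {l : ℕ → ℝ} {m : ℕ} (hm : 0 < m) {B : ℝ}
    (hB : ∀ j, |l (j + 1) - l j| ≤ B) :
    ∃ Λ : ℤ → ℝ, (∀ j, Λ (j + m) = Λ j + (l m - l 0)) ∧ (∀ j, |Λ (j + 1) - Λ j| ≤ B) ∧
      ∀ j : ℕ, j ≤ m → Λ j = l j := by
  have hm' : (0 : ℤ) < m := by exact_mod_cast hm
  set c := l m - l 0 with hc
  set Λ : ℤ → ℝ := fun j => l (j % m).toNat + (j / m : ℤ) * c with hΛ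
  have hper : ∀ j, Λ (j + m) = Λ j + c := fun j => by
    simp only [hΛ, Int.add_emod_right, Int.add_ediv_of_dvd_right (dvd_refl (m : ℤ)),
      Int.ediv_self hm'.ne']
    push_cast; ring
  have hval : ∀ j : ℕ, j ≤ m → Λ j = l j := fun j hj => by
    rcases hj.eq_or_lt with rfl | hj
    · have h0 : Λ 0 = l 0 := by simp [hΛ]
      have := hper 0
      rw [zero_add, h0] at this
      rw [this, hc]; ring
    · have h1 : (j : ℤ) < m := by exact_mod_cast hj
      have h2 : (0 : ℤ) ≤ j := by positivity
      simp [hΛ, Int.emod_eq_of_lt h2 h1, Int.ediv_eq_zero_of_lt h2 h1]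
  refine ⟨Λ, hper, fun j => ?_, hval⟩
  have hshift : ∀ (k : ℤ) j, Λ (j + k * m) = Λ j + k * c := fun k j => by
    simp only [hΛ, Int.add_mul_emod_self_right, Int.add_mul_ediv_right _ _ hm'.ne']
    push_cast; ring
  obtain ⟨n, hn⟩ := Int.eq_ofNat_of_zero_le (Int.emod_nonneg j hm'.ne')
  have hnm : n < m := by
    have := Int.emod_lt_of_pos j hm'; omega
  have hj : j = n + (j / m) * m := by
    have := Int.emod_add_mul_ediv j m
    rw [hn] at this; linarith
  have e1 : Λ j = Λ n + (j / m : ℤ) * c := by conv_lhs => rw [hj, hshift]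
  have e2 : Λ (j + 1) = Λ (n + 1 : ℕ) + (j / m : ℤ) * c := by
    rw [← hshift]; congr 1; push_cast; linarith
  rw [e1, e2, hval _ hnm, hval _ hnm.le, add_sub_add_right_eq_sub]
  exact hB n

/-- A uniform grid along which a bounded function is close, in the mean, to its values at the
grid points. -/
lemma exists_grid {τ : ℝ → Plane} (hτ : StronglyMeasurable τ) (hb : ∀ s, ‖τ s‖ ≤ 1)
    {G : ℝ → Prop} (hG : ∀ᵐ s, G s) {L : ℝ} (hL : 0 < L) {η h₀ : ℝ} (hη : 0 < η) (hh₀ : 0 < h₀) :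
    ∃ (m : ℕ) (h t₀ : ℝ), 0 < m ∧ 0 < h ∧ h ≤ h₀ ∧ m * h = L ∧ (∀ j : ℕ, G (t₀ + j * h)) ∧
      (∑ j ∈ Finset.range m, ∫ s in (t₀ + j * h)..(t₀ + (j + 1 : ℕ) * h),
        ‖τ s - τ (t₀ + j * h)‖) ≤ η ∧
      ∑ j ∈ Finset.range m, h * ‖τ (t₀ + j * h) - τ (t₀ + (j + 1 : ℕ) * h)‖ ≤ η := by
  set e := η / (3 + 2 * L) with he
  have he0 : 0 < e := by positivity
  have hint : Integrable (indicator (Icc 0 (2 * L)) τ) := by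
    rw [integrable_indicator_iff measurableSet_Icc]
    exact Measure.integrableOn_of_bounded (M := 1) measure_Icc_lt_top.ne hτ.aestronglyMeasurable
      (Eventually.of_forall hb)
  -- A continuous `g` approximates `τ` in `L¹` on `[0, 2L]`, a window containing the shifted grid
  -- because `t₀ ≤ h < L`.
  obtain ⟨g, -, hge, hgcont, hgi⟩ := hint.exists_hasCompactSupport_integral_sub_le he0
  set d : ℝ → ℝ := fun s => ‖indicator (Icc 0 (2 * L)) τ s - g s‖ with hd
  have hdi : Integrable d := (hint.sub hgi).norm
  have hd0 : ∀ s, 0 ≤ d s := fun s => norm_nonneg _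
  obtain ⟨δ, hδ, hunif⟩ := Metric.uniformContinuousOn_iff.1
    ((isCompact_Icc (a := 0) (b := 2 * L)).uniformContinuousOn_of_continuous hgcont.continuousOn) e he0
  obtain ⟨m, hm⟩ := exists_nat_gt (L / min (min δ h₀) L)
  have hmin : 0 < min (min δ h₀) L := by positivity
  have hm0 : (0 : ℝ) < m := lt_of_le_of_lt (by positivity) hm
  set h := L / m with hh
  have hhpos : 0 < h := by positivity
  have hhlt : h < min (min δ h₀) L := by
    rw [hh, div_lt_iff₀ hm0]; rw [div_lt_iff₀ hmin] at hm; linarith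
  have hmh : m * h = L := by rw [hh]; field_simp
  rw [lt_min_iff, lt_min_iff] at hhlt
  have hdI : ∀ a b, IntervalIntegrable d volume a b := fun a b => hdi.intervalIntegrable
  have hsub : ∀ a b, a ≤ b → ∫ s in a..b, d s ≤ e := fun a b hab => by
    rw [intervalIntegral.integral_of_le hab]
    exact (setIntegral_le_integral hdi (Eventually.of_forall hd0)).trans hge
  -- The offset of the grid is chosen by averaging: the integral of `D` over one cell is the
  -- integral of `d` over `m + 1` cells, so some offset has `h * D ≤ e` and avoids the null set
  -- where `G` fails. The term `j = m` is there because the last increment involves the end point.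
  set D : ℝ → ℝ := fun t => ∑ j ∈ Finset.range (m + 1), d (t + j * h) with hD
  have hDi : IntegrableOn D (Ioc 0 h) := by
    refine integrable_finsetSum _ fun j _ => ?_
    exact (hdi.comp_add_right (j * h)).integrableOn
  have hDint : ∫ t in (0 : ℝ)..h, D t ≤ e := by
    simp only [hD]
    rw [intervalIntegral.integral_finsetSum (f := fun (j : ℕ) t => d (t + j * h))
      fun j _ => (hdi.comp_add_right ((j : ℝ) * h)).intervalIntegrable]
    have e1 : ∀ j ∈ Finset.range (m + 1), ∫ t in (0 : ℝ)..h, d (t + j * h)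
        = ∫ s in ((j : ℕ) * h : ℝ)..((j + 1 : ℕ) * h : ℝ), d s := fun j _ => by
      rw [intervalIntegral.integral_comp_add_right]; congr 1 <;> push_cast <;> ring
    rw [Finset.sum_congr rfl e1, intervalIntegral.sum_integral_adjacent_intervals
      (a := fun j : ℕ => (j : ℝ) * h) fun j _ => hdI _ _]
    exact hsub _ _ (mul_le_mul_of_nonneg_right (by exact_mod_cast Nat.zero_le _) hhpos.le)
  have hGall : ∀ᵐ t, ∀ j : ℕ, G (t + j * h) := by
    rw [ae_all_iff]
    intro j
    exact (measurePreserving_add_right volume ((j : ℝ) * h)).quasiMeasurePreserving.ae hG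
  obtain ⟨t₀, ht₀, hGt, hDt⟩ : ∃ t₀ ∈ Ioc 0 h, (∀ j : ℕ, G (t₀ + j * h)) ∧ h * D t₀ ≤ e := by
    have hvol : volume.restrict (Ioc 0 h) ≠ 0 := by simp [hhpos]
    have hnull : volume.restrict (Ioc 0 h) {t | ¬(t ∈ Ioc 0 h ∧ ∀ j : ℕ, G (t + j * h))} = 0 :=
      (ae_restrict_mem measurableSet_Ioc).and (ae_restrict_of_ae hGall)
    obtain ⟨t, ht, hDt⟩ := exists_notMem_null_le_average hvol hDi hnull
    simp only [mem_ofPred_eq, not_not] at ht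
    refine ⟨t, ht.1, ht.2, ?_⟩
    rw [setAverage_eq, ← intervalIntegral.integral_of_le hhpos.le, Real.volume_real_Ioc_of_le hhpos.le,
      sub_zero, smul_eq_mul, ← div_eq_inv_mul, le_div_iff₀ hhpos] at hDt
    linarith
  set s : ℕ → ℝ := fun j => t₀ + j * h with hs
  have hs_succ : ∀ j, s (j + 1) = s j + h := fun j => by simp only [hs]; push_cast; ring
  have hrange : ∀ j ≤ m, 0 ≤ s j ∧ s j ≤ 2 * L := fun j hj => by
    have h1 : (j : ℝ) ≤ m := by exact_mod_cast hj
    have h2 : (j : ℝ) * h ≤ m * h := by gcongr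
    have h3 : 0 ≤ (j : ℝ) * h := by positivity
    simp only [hs]
    constructor <;> linarith [ht₀.1, ht₀.2, hhlt.2]
  have htri : ∀ x y, x ∈ Icc 0 (2 * L) → y ∈ Icc 0 (2 * L) → |x - y| ≤ h →
      ‖τ x - τ y‖ ≤ d x + e + d y := by
    intro x y hx hy hxy
    have h1 : dist (g x) (g y) < e := hunif x hx y hy (by rw [Real.dist_eq]; linarith [hhlt.1.1])
    have h2 : d x = ‖τ x - g x‖ := by simp only [hd, indicator_of_mem hx]
    have h3 : d y = ‖τ y - g y‖ := by simp only [hd, indicator_of_mem hy]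
    rw [dist_eq_norm] at h1
    have e1 : τ x - τ y = (τ x - g x) + (g x - g y) - (τ y - g y) := by abel
    rw [e1, h2, h3]
    have h4 := norm_sub_le ((τ x - g x) + (g x - g y)) (τ y - g y)
    have h5 := norm_add_le (τ x - g x) (g x - g y)
    linarith
  have hsum : h * ∑ j ∈ Finset.range m, d (s j) ≤ e := by
    refine le_trans ?_ hDt
    gcongr
    exact Finset.sum_le_sum_of_subset_of_nonneg (Finset.range_subset_range.2 (by omega))
      fun j _ _ => hd0 _
  have hsum' : h * ∑ j ∈ Finset.range m, d (s (j + 1)) ≤ e := by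
    refine le_trans ?_ hDt
    gcongr
    simp only [hD]
    rw [Finset.sum_range_succ']
    linarith [hd0 (t₀ + (0 : ℕ) * h)]
  refine ⟨m, h, t₀, by exact_mod_cast hm0, hhpos, hhlt.1.2.le, hmh, hGt, ?_, ?_⟩
  · have hj : ∀ j ∈ Finset.range m, ∫ x in (s j)..(s (j + 1)), ‖τ x - τ (s j)‖
        ≤ (∫ x in (s j)..(s (j + 1)), d x) + h * (e + d (s j)) := by
      intro j hj
      rw [Finset.mem_range] at hj
      have hle : s j ≤ s (j + 1) := by rw [hs_succ]; linarith
      have e1 : (∫ x in (s j)..(s (j + 1)), d x) + h * (e + d (s j))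
          = ∫ x in (s j)..(s (j + 1)), (d x + (e + d (s j))) := by
        rw [intervalIntegral.integral_add (hdI _ _) intervalIntegrable_const,
          intervalIntegral.integral_const, hs_succ, add_sub_cancel_left, smul_eq_mul]
      rw [e1]
      refine intervalIntegral.integral_mono_on hle ?_ ((hdI _ _).add intervalIntegrable_const) ?_
      · refine intervalIntegrable_of_bound (B := 2)
          ((hτ.sub stronglyMeasurable_const).norm) (fun x => ?_) _ _
        rw [norm_norm]
        refine (norm_sub_le _ _).trans ?_
        linarith [hb x, hb (s j)]
      · intro x hx
        have := htri x (s j) ⟨(hrange j hj.le).1.trans hx.1, hx.2.trans (hrange (j + 1) hj).2⟩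
          (hrange j hj.le) (by
            rw [abs_of_nonneg (by linarith [hx.1])]; linarith [hx.2, hs_succ j])
        linarith
    refine (Finset.sum_le_sum hj).trans ?_
    rw [Finset.sum_add_distrib, intervalIntegral.sum_integral_adjacent_intervals
      (fun j _ => hdI _ _), ← Finset.mul_sum, Finset.sum_add_distrib, Finset.sum_const,
      Finset.card_range, nsmul_eq_mul]
    have h1 := hsub (s 0) (s m) (by simp only [hs]; push_cast; nlinarith)
    have h2 : h * (m * e) = L * e := by rw [← hmh]; ring
    have h3 : e * (3 + 2 * L) = η := by rw [he]; field_simp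
    nlinarith
  · have hj : ∀ j ∈ Finset.range m, h * ‖τ (s j) - τ (s (j + 1))‖
        ≤ h * (d (s j) + e + d (s (j + 1))) := by
      intro j hj
      rw [Finset.mem_range] at hj
      gcongr
      refine htri _ _ (hrange j hj.le) (hrange (j + 1) hj) ?_
      rw [hs_succ, abs_sub_comm, add_sub_cancel_left, abs_of_pos hhpos]
    refine (Finset.sum_le_sum hj).trans ?_
    rw [← Finset.mul_sum, Finset.sum_add_distrib, Finset.sum_add_distrib, Finset.sum_const,
      Finset.card_range, nsmul_eq_mul]
    have h2 : h * (m * e) = L * e := by rw [← hmh]; ring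
    have h3 : e * (3 + 2 * L) = η := by rw [he]; field_simp
    nlinarith

/-! ### Transfer of the tangent directions to the approximating unit sphere. -/

lemma norm_normal_eq {γ : ℝ → Plane} {s : ℝ} (h : ‖tangent γ s‖ = 1) : ‖normal γ s‖ = 1 := by
  rw [normal, norm_perp, h]

namespace IsCahnHoffmanCurve

variable {φ φ' : Plane → ℝ} {γ N p : ℝ → Plane} {L C : ℝ} {π : Plane → Plane}

/-- A parameter at which the curve has a unit tangent and the field satisfies the Cahn-Hoffman
condition. -/
def Good (φ : Plane → ℝ) (γ N : ℝ → Plane) (s : ℝ) : Prop :=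
  ‖tangent γ s‖ = 1 ∧ N s ∈ subdifferential (polar φ) (normal γ s)

/-- Moving from `N s` along the normal leads beyond a supporting line of the ball. The pushed-out
path thus stays where the projection lands on the sphere. -/
lemma one_le_of_mem_segment (hφ : IsAnisotropy φ) {s t : ℝ} (hs : Good φ γ N s) (ht : 0 ≤ t)
    {z : Plane} (hz : z ∈ segment ℝ (N s) (N s + t • normal γ s)) : 1 ≤ φ z := by
  have hν : normal γ s ≠ 0 := norm_pos_iff.1 (by rw [norm_normal_eq hs.1]; exact one_pos)
  rw [segment_eq_image'] at hz
  obtain ⟨θ, hθ, rfl⟩ := hz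
  refine hφ.one_le_of_polar_le_inner hν ?_
  simp only
  rw [add_sub_cancel_left, inner_add_left, real_inner_smul_left, real_inner_smul_left,
    real_inner_self_eq_norm_sq, hφ.inner_eq_of_mem_subdifferential hs.2]
  have := hθ.1
  have : 0 ≤ θ * (t * ‖normal γ s‖ ^ 2) := by positivity
  linarith

variable (hc : IsCahnHoffmanCurve φ γ N L C)
include hc

lemma nonneg : 0 ≤ C := by
  have := hc.field_lipschitz 1 0
  rw [sub_zero, abs_one, mul_one] at this
  exact (norm_nonneg _).trans this

/-- The nearest-point projections of the field, pushed out a little, are joined by short arcs. -/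
lemma exists_transition (hφ : IsAnisotropy φ) (hφ' : IsAnisotropy φ') (hle : ∀ x, φ x ≤ φ' x)
    (hp : IsUnitSphereParam φ' p) (hπ : IsUnitBallProj φ' π) {κ t : ℝ} (hκ : 0 < κ) (ht : 0 ≤ t)
    {s s' : ℝ} (hs : Good φ γ N s) (hs' : Good φ γ N s') {a : ℝ}
    (ha : p a = π (N s + t • normal γ s)) :
    ∃ b, p b = π (N s' + t • normal γ s') ∧ |b - a| ≤ (1 + κ) * (C * |s' - s| + 2 * t) := by
  -- The connecting path goes in along the normal, follows the field, and goes out along the next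
  -- normal; its lengths are at most `t`, `C |s' - s|` and `t`.
  obtain ⟨b₁, hb₁, h₁⟩ := hp.exists_lift_segment hφ' hπ hκ (x := N s + t • normal γ s) (y := N s)
    (fun z hz => (one_le_of_mem_segment hφ hs ht (by rwa [segment_symm])).trans (hle z)) ha
  obtain ⟨b₂, hb₂, h₂⟩ := hp.exists_lift hφ' hπ hκ (c := fun x => N (s + x * (s' - s)))
    (K := C * |s' - s|) (mul_nonneg hc.nonneg (abs_nonneg _)) (fun x _ y _ => by
      refine (hc.field_lipschitz _ _).trans_eq ?_
      rw [show s + x * (s' - s) - (s + y * (s' - s)) = (s' - s) * (x - y) by ring, abs_mul]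
      ring) (fun x _ => (hc.field_mem _).ge.trans (hle _)) (a := b₁) (by simpa using hb₁)
  obtain ⟨b₃, hb₃, h₃⟩ := hp.exists_lift_segment hφ' hπ hκ (x := N s')
    (y := N s' + t • normal γ s')
    (fun z hz => (one_le_of_mem_segment hφ hs' ht hz).trans (hle z)) (a := b₂) (by simpa using hb₂)
  refine ⟨b₃, hb₃, ?_⟩
  have e1 : ‖N s - (N s + t • normal γ s)‖ = t := by
    rw [sub_add_cancel_left, norm_neg, norm_smul, norm_normal_eq hs.1, mul_one,
      Real.norm_of_nonneg ht]
  have e3 : ‖N s' + t • normal γ s' - N s'‖ = t := by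
    rw [add_sub_cancel_left, norm_smul, norm_normal_eq hs'.1, mul_one, Real.norm_of_nonneg ht]
  rw [e1] at h₁
  rw [e3] at h₃
  have h4 := abs_sub_le b₃ b₂ a
  have h5 := abs_sub_le b₂ b₁ a
  linarith

/-- The tangent of the unit sphere of the approximating anisotropy at the projected point. -/
lemma norm_deriv_add_tangent_le (hφ : IsAnisotropy φ) (hφ' : IsAnisotropy φ')
    (hle : ∀ x, φ x ≤ φ' x) {δ : ℝ} (hδ : 0 < δ) (hge : ∀ x, φ' x ≤ (1 + δ) * φ x)
    (hp : IsUnitSphereParam φ' p) (hπ : IsUnitBallProj φ' π) {r : ℝ} (hr : 0 < r)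
    (hlow : ∀ x, r * ‖x‖ ≤ φ x) {t : ℝ} (ht : 0 < t) {s : ℝ} (hs : Good φ γ N s) {a : ℝ}
    (ha : p a = π (N s + t • normal γ s)) :
    ‖-deriv p a - tangent γ s‖ ^ 2 ≤ 2 * (δ / r) / t := by
  -- Shrinking `N s` by `1 + δ` puts it into the `φ'`-ball, at the cost of a displacement of at most
  -- `δ / r`.
  have h1 := hp.norm_normal_sub_le hφ' hπ (n := N s) (ν := normal γ s)
    (y := (1 + δ)⁻¹ • N s) (d := δ / r) (norm_normal_eq hs.1) (fun w hw => by
      rw [hφ.inner_eq_of_mem_subdifferential hs.2]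
      exact hφ.inner_le_polar ((hle w).trans hw) _) (by
      rw [hφ'.smul, abs_of_pos (by positivity), inv_mul_le_iff₀ (by positivity)]
      have := hge (N s)
      rwa [hc.field_mem] at this) (by
      have e : N s - (1 + δ)⁻¹ • N s = (1 - (1 + δ)⁻¹) • N s := by rw [sub_smul, one_smul]
      have e2 : 1 - (1 + δ)⁻¹ = δ * (1 + δ)⁻¹ := by field_simp; ring
      rw [e, e2, norm_smul, Real.norm_of_nonneg (by positivity)]
      have h2 := hlow (N s)
      rw [hc.field_mem] at h2
      have h3 : ‖N s‖ ≤ 1 / r := by rw [le_div_iff₀ hr]; linarith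
      have h4 : (1 + δ)⁻¹ ≤ 1 := inv_le_one_of_one_le₀ (by linarith)
      calc δ * (1 + δ)⁻¹ * ‖N s‖ ≤ δ * 1 * (1 / r) := by gcongr
        _ = δ / r := by ring) ht ha
  have e : -perp (deriv p a) - normal γ s = perp (-deriv p a - tangent γ s) := by
    rw [perp_sub, perp_neg]; rfl
  rwa [e, norm_perp] at h1

/-- The tangent of the curve is approximated in the mean by the tangents of the approximating unit
sphere at points which move at a speed only slightly larger than that of the field. -/
lemma exists_angle (hφ : IsAnisotropy φ) {C₁ : ℝ} (hC₁ : C < C₁) {η : ℝ} (hη : 0 < η) :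
    ∃ δ, 0 < δ ∧ ∀ φ' : Plane → ℝ, IsAnisotropy φ' → (∀ x, φ x ≤ φ' x) →
      (∀ x, φ' x ≤ (1 + δ) * φ x) → ∀ p, IsUnitSphereParam φ' p →
      ∃ (l : ℝ → ℝ) (c : ℝ), ContDiff ℝ ∞ l ∧ (∀ s, |deriv l s| ≤ C₁) ∧
        (∀ s, l (s + L) = l s + c) ∧ Function.Periodic p c ∧
        ∫ s in (0 : ℝ)..L, ‖-deriv p (l s) - tangent γ s‖ ≤ η := by
  have hL := hc.pos
  have hC0 := hc.nonneg
  have hC₁0 : 0 < C₁ := hC0.trans_lt hC₁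
  obtain ⟨R, hR, hup⟩ := hφ.exists_upper
  obtain ⟨r, hr, hlow⟩ := hφ.exists_lower
  -- The mesh bound keeps arcs of length `C₁ h` below `(2R)⁻¹`, the scale on which the tangents of
  -- `{φ' = 1}` are controlled by their end values; `2R` bounds `φ'` as soon as `δ ≤ 1`.
  obtain ⟨m, h, t₀, hm, hh, hh₀, hmh, hgood, hsum1, hsum2⟩ := exists_grid
    (stronglyMeasurable_deriv γ) hc.norm_tangent_le hc.good hL (η := η / 8)
    (h₀ := (2 * R)⁻¹ / (2 * C₁)) (by positivity) (by positivity)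
  set s : ℕ → ℝ := fun j => t₀ + j * h with hs
  -- With `2 t = κ h`, one grid step costs `(1 + κ)(C + κ) h`, and this choice of `κ` keeps it below
  -- `C₁ h`.
  set κ : ℝ := min 1 ((C₁ - C) / (C + 2)) with hκ
  have hκ0 : 0 < κ := lt_min one_pos (div_pos (by linarith) (by linarith))
  have hκ1 : (1 + κ) * (C + κ) ≤ C₁ := by
    have h1 : κ ≤ 1 := min_le_left _ _
    have h2 : κ * (C + 2) ≤ C₁ - C := by
      rw [← le_div_iff₀ (by linarith)]; exact min_le_right _ _
    nlinarith
  set t : ℝ := κ * h / 2 with ht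
  have ht0 : 0 < t := by positivity
  set θ : ℝ := η / (16 * L) with hθ
  have hθ0 : 0 < θ := by positivity
  -- `δ` depends on the push `t`, hence on the grid, which is fixed independently of `φ'`.
  refine ⟨min 1 (θ ^ 2 * r * t / 2), by positivity, ?_⟩
  set δ : ℝ := min 1 (θ ^ 2 * r * t / 2) with hδ
  have hδ0 : 0 < δ := by positivity
  have hδθ : 2 * (δ / r) / t ≤ θ ^ 2 := by
    have : δ ≤ θ ^ 2 * r * t / 2 := min_le_right _ _
    rw [div_le_iff₀ ht0, ← mul_div_assoc, div_le_iff₀ hr]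
    linarith
  intro φ' hφ' hle hge p hp
  obtain ⟨π, hπ⟩ := hφ'.exists_unitBallProj
  have hup' : ∀ x, φ' x ≤ 2 * R * ‖x‖ := fun x => by
    have h1 : δ ≤ 1 := min_le_left _ _
    have := hge x
    nlinarith [hup x, hφ.nonneg x]
  set X : ℝ → Plane := fun s => N s + t • normal γ s with hX
  have hX1 : ∀ j, 1 ≤ φ' (X (s j)) := fun j =>
    (one_le_of_mem_segment hφ (hgood j) ht0.le (right_mem_segment ℝ _ _)).trans (hle _)
  obtain ⟨a₀, ha₀⟩ : ∃ a, p a = π (X (s 0)) := by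
    obtain ⟨K, -, hK⟩ := hp.exists_near
    obtain ⟨a, ha, -⟩ := hK 0 _ (hπ.proj_eq_one hφ' (hX1 0))
    exact ⟨a, ha⟩
  have hstep : ∀ (j : ℕ) (a : {a // p a = π (X (s j))}),
      ∃ b : {a // p a = π (X (s (j + 1)))}, |(b : ℝ) - a| ≤ C₁ * h := by
    rintro j ⟨a, ha⟩
    obtain ⟨b, hb, hba⟩ := hc.exists_transition hφ hφ' hle hp hπ hκ0 ht0.le (hgood j)
      (hgood (j + 1)) ha
    refine ⟨⟨b, hb⟩, hba.trans ?_⟩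
    have e1 : |s (j + 1) - s j| = h := by
      rw [show s (j + 1) - s j = h by simp only [hs]; push_cast; ring, abs_of_pos hh]
    calc (1 + κ) * (C * |s (j + 1) - s j| + 2 * t) = (1 + κ) * (C + κ) * h := by
          rw [e1, ht]; ring
      _ ≤ C₁ * h := by gcongr
  choose nxt hnxt using hstep
  let q : (j : ℕ) → {a // p a = π (X (s j))} := fun j => Nat.rec ⟨a₀, ha₀⟩ nxt j
  have hqstep : ∀ j, |(q (j + 1)).1 - (q j).1| ≤ C₁ * h := fun j => hnxt j (q j)
  obtain ⟨Λ, hΛper, hΛstep, hΛq⟩ := exists_int_extension (l := fun j : ℕ => (q j).1) hm hqstep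
  set c : ℝ := (q m).1 - (q 0).1 with hcdef
  have hperc : Function.Periodic p c := by
    -- The data at `s 0` and `s 0 + L` coincide, so both lifts represent one point of the sphere and
    -- differ by a period.
    refine hp.translate _ _ ?_
    rw [(q m).2, (q 0).2]
    have hsm : s m = s 0 + L := by simp only [hs]; rw [hmh]; push_cast; ring
    have hn : normal γ (s 0 + L) = normal γ (s 0) := by
      simp only [normal]; rw [hc.tangent_periodic]
    simp only [hX, hsm, hn, hc.field_periodic (s 0)]
  obtain ⟨l₀, hl₀lip, hl₀per, hl₀mem⟩ := exists_piecewise_linear hh hΛper hΛstep t₀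
  obtain ⟨d, hd, hunif⟩ := Metric.uniformContinuous_iff.1 hp.uniformContinuous_deriv θ hθ0
  have hl₀cont : Continuous l₀ := by
    have : LipschitzWith C₁.toNNReal l₀ := by
      apply LipschitzWith.of_dist_le_mul
      intro x y
      rw [Real.dist_eq, Real.dist_eq, Real.coe_toNNReal _ hC₁0.le]
      exact hl₀lip x y
    exact this.continuous
  rw [hmh] at hl₀per
  obtain ⟨l, hls, hlapprox, hlinc⟩ := exists_smooth_approx hl₀cont hL hl₀per (half_pos hd)
  have hlper : ∀ x, l (x + L) = l x + c := fun x => by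
    refine le_antisymm (hlinc L c (fun y => (hl₀per y).le) x) ?_
    -- Inherited increment bounds for the shifts `L` and `-L` together give the exact relation.
    have h1 := hlinc (-L) (-c) (fun y => by
      have := hl₀per (y + -L); rw [neg_add_cancel_right] at this; linarith) (x + L)
    rw [add_neg_cancel_right] at h1
    linarith
  have hllip : ∀ x y, |l x - l y| ≤ C₁ * |x - y| := fun x y => by
    have key : ∀ x y, l x - l y ≤ C₁ * |x - y| := fun x y => by
      have h1 := hlinc (x - y) (C₁ * |x - y|) (fun z => by
        have h2 := hl₀lip (z + (x - y)) z
        rw [add_sub_cancel_left] at h2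
        linarith [le_abs_self (l₀ (z + (x - y)) - l₀ z)]) y
      rw [add_sub_cancel] at h1
      linarith
    rw [abs_le]
    have h1 := key x y
    have h2 := key y x
    rw [abs_sub_comm] at h2
    constructor <;> linarith
  refine ⟨l, c, hls, fun x => ?_, hlper, hperc, ?_⟩
  · have hlw : LipschitzWith C₁.toNNReal l := by
      apply LipschitzWith.of_dist_le_mul
      intro x y
      rw [Real.dist_eq, Real.dist_eq, Real.coe_toNNReal _ hC₁0.le]
      exact hllip x y
    have := norm_deriv_le_of_lipschitz hlw (x₀ := x)
    rwa [Real.coe_toNNReal _ hC₁0.le, Real.norm_eq_abs] at this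
  set E : ℝ → ℝ := fun s => ‖-deriv p (l s) - tangent γ s‖ with hE
  have hEper : Function.Periodic E L := fun x => by
    simp only [hE, hlper, hperc.deriv_periodic (l x), hc.tangent_periodic x]
  have hEint : ∀ a b, IntervalIntegrable E volume a b := fun a b => by
    refine intervalIntegrable_of_bound (B := 2) ?_ (fun x => ?_) a b
    · exact (((hp.contDiff_deriv.continuous.comp hls.continuous).neg.stronglyMeasurable).sub
        (stronglyMeasurable_deriv γ)).norm
    · rw [norm_norm]
      refine (norm_sub_le _ _).trans ?_
      rw [norm_neg, hp.speed]
      linarith [hc.norm_tangent_le x]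
  -- The term `8 θ` collects `θ` from mollification, `θ` from the grid point `s j`, and `3 * 2 θ`
  -- from the comparison of the arc with its end tangents.
  have hpt : ∀ j < m, ∀ x, s j ≤ x → x < s (j + 1) → E x ≤ 8 * θ
      + 3 * ‖tangent γ (s j) - tangent γ (s (j + 1))‖ + ‖tangent γ x - tangent γ (s j)‖ := by
    intro j hj x hx1 hx2
    have hx := hl₀mem j x hx1 (by simpa [hs] using hx2)
    have e1 : Λ j = (q j).1 := hΛq j hj.le
    have e2 : Λ (j + 1) = (q (j + 1)).1 := by exact_mod_cast hΛq (j + 1) hj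
    rw [e1, e2] at hx
    have b1 : ‖deriv p (l x) - deriv p (l₀ x)‖ ≤ θ := by
      rw [← dist_eq_norm]
      refine (hunif ?_).le
      rw [Real.dist_eq]; linarith [hlapprox x]
    have hshort : C₁ * h < (2 * R)⁻¹ := by
      have h1 : C₁ * h ≤ C₁ * ((2 * R)⁻¹ / (2 * C₁)) := by gcongr
      have h2 : C₁ * ((2 * R)⁻¹ / (2 * C₁)) = (2 * R)⁻¹ / 2 := by field_simp
      have h3 : 0 < (2 * R)⁻¹ := by positivity
      linarith
    have b2 := hp.norm_deriv_sub_le hφ' (by positivity : 0 < 2 * R) hup' hx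
      ((hqstep j).trans_lt hshort)
    have hT : ∀ i, ‖-deriv p (q i).1 - tangent γ (s i)‖ ≤ θ := fun i => by
      have h1 := (hc.norm_deriv_add_tangent_le hφ hφ' hle hδ0 hge hp hπ hr hlow ht0 (hgood i)
        (q i).2).trans hδθ
      exact (pow_le_pow_iff_left₀ (norm_nonneg _) hθ0.le two_ne_zero).1 h1
    have b3 : ‖deriv p (q j).1 - deriv p (q (j + 1)).1‖
        ≤ 2 * θ + ‖tangent γ (s j) - tangent γ (s (j + 1))‖ := by
      have e : deriv p (q j).1 - deriv p (q (j + 1)).1 =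
          (-deriv p (q (j + 1)).1 - tangent γ (s (j + 1))) - (-deriv p (q j).1 - tangent γ (s j))
          - (tangent γ (s j) - tangent γ (s (j + 1))) := by abel
      rw [e]
      have h1 := norm_sub_le ((-deriv p (q (j + 1)).1 - tangent γ (s (j + 1)))
        - (-deriv p (q j).1 - tangent γ (s j))) (tangent γ (s j) - tangent γ (s (j + 1)))
      have h2 := norm_sub_le (-deriv p (q (j + 1)).1 - tangent γ (s (j + 1)))
        (-deriv p (q j).1 - tangent γ (s j))
      linarith [hT j, hT (j + 1)]
    have e : -deriv p (l x) - tangent γ x = (-deriv p (q j).1 - tangent γ (s j))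
        - (deriv p (l x) - deriv p (l₀ x)) - (deriv p (l₀ x) - deriv p (q j).1)
        - (tangent γ x - tangent γ (s j)) := by abel
    have h1 := norm_sub_le ((-deriv p (q j).1 - tangent γ (s j))
        - (deriv p (l x) - deriv p (l₀ x)) - (deriv p (l₀ x) - deriv p (q j).1))
        (tangent γ x - tangent γ (s j))
    have h2 := norm_sub_le ((-deriv p (q j).1 - tangent γ (s j))
        - (deriv p (l x) - deriv p (l₀ x))) (deriv p (l₀ x) - deriv p (q j).1)
    have h3 := norm_sub_le (-deriv p (q j).1 - tangent γ (s j)) (deriv p (l x) - deriv p (l₀ x))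
    simp only [hE]
    rw [e]
    linarith [hT j]
  have hpiece : ∀ j ∈ Finset.range m, ∫ x in (s j)..(s (j + 1)), E x ≤ 8 * θ * h
      + 3 * (h * ‖tangent γ (s j) - tangent γ (s (j + 1))‖)
      + ∫ x in (s j)..(s (j + 1)), ‖tangent γ x - tangent γ (s j)‖ := by
    intro j hj
    rw [Finset.mem_range] at hj
    have hsucc : s (j + 1) - s j = h := by simp only [hs]; push_cast; ring
    have hint : IntervalIntegrable (fun x => ‖tangent γ x - tangent γ (s j)‖) volume (s j)
        (s (j + 1)) := by
      refine intervalIntegrable_of_bound (B := 2)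
        (((stronglyMeasurable_deriv γ).sub stronglyMeasurable_const).norm) (fun x => ?_) _ _
      rw [norm_norm]
      refine (norm_sub_le _ _).trans ?_
      have h1 := hc.norm_tangent_le x
      have h2 := hc.norm_tangent_le (s j)
      unfold tangent at h1 h2 ⊢
      linarith
    have e1 : 8 * θ * h + 3 * (h * ‖tangent γ (s j) - tangent γ (s (j + 1))‖)
        + ∫ x in (s j)..(s (j + 1)), ‖tangent γ x - tangent γ (s j)‖
        = ∫ x in (s j)..(s (j + 1)), (8 * θ
      + 3 * ‖tangent γ (s j) - tangent γ (s (j + 1))‖ + ‖tangent γ x - tangent γ (s j)‖) := by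
      rw [intervalIntegral.integral_add intervalIntegrable_const hint,
        intervalIntegral.integral_const, hsucc, smul_eq_mul]
      ring
    rw [e1]
    refine intervalIntegral.integral_mono_on_of_le_Ioo (by linarith) (hEint _ _)
      (intervalIntegrable_const.add hint) fun x hx => hpt j hj x hx.1.le hx.2
  have e0 : ∫ x in (0 : ℝ)..L, E x = ∫ x in (s 0)..(s m), E x := by
    have := hEper.intervalIntegral_add_eq 0 (s 0)
    rw [zero_add] at this
    rw [this]
    congr 1
    simp only [hs]; rw [hmh]; push_cast; ring
  rw [e0, ← intervalIntegral.sum_integral_adjacent_intervals (a := s) fun j _ => hEint _ _]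
  refine (Finset.sum_le_sum hpiece).trans ?_
  rw [Finset.sum_add_distrib, Finset.sum_add_distrib, Finset.sum_const, Finset.card_range,
    nsmul_eq_mul, ← Finset.mul_sum]
  have e1 : (m : ℝ) * (8 * θ * h) = η / 2 := by
    rw [show (m : ℝ) * (8 * θ * h) = 8 * θ * (m * h) by ring, hmh, hθ]; field_simp; norm_num
  have f1 : ∑ j ∈ Finset.range m, ∫ x in (s j)..(s (j + 1)), ‖tangent γ x - tangent γ (s j)‖
      ≤ η / 8 := hsum1
  have f2 : ∑ j ∈ Finset.range m, h * ‖tangent γ (s j) - tangent γ (s (j + 1))‖ ≤ η / 8 := hsum2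
  linarith

end IsCahnHoffmanCurve

/-! ### Closing up the curve and restoring its parametrization. -/

/-- A continuous monotone change of parameter is a uniform limit of smooth ones. -/
lemma exists_smooth_reparam {σ : ℝ → ℝ} (hσ : Continuous σ) (hmono : Monotone σ) {p c : ℝ}
    (hp : 0 < p) (hc : 0 < c) (hper : ∀ x, σ (x + p) = σ x + c) {δ : ℝ} (hδ : 0 < δ) :
    ∃ g : ℝ → ℝ, ContDiff ℝ ∞ g ∧ (∀ x, 0 < deriv g x) ∧ (∀ x, g (x + p) = g x + c) ∧
      ∀ x, |g x - σ x| ≤ δ := by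
  obtain ⟨B, hB⟩ : ∃ B, ∀ x, |c / p * x - σ x| ≤ B := by
    have h1 : Function.Periodic (fun x => c / p * x - σ x) p := fun x => by
      simp only [hper]; field_simp; ring
    have hb := h1.isBounded_of_continuous hp.ne' ((continuous_const.mul continuous_id).sub hσ)
    obtain ⟨B, hB⟩ := hb.exists_norm_le
    exact ⟨B, fun x => hB _ ⟨x, rfl⟩⟩
  have hB0 : 0 ≤ B := (abs_nonneg _).trans (hB 0)
  set k : ℝ := min (1 / 2) (δ / (2 * (B + 1))) with hk
  have hk0 : 0 < k := by positivity
  have hk1 : k ≤ 1 / 2 := min_le_left _ _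
  have hkB : k * B ≤ δ / 2 := by
    have : k ≤ δ / (2 * (B + 1)) := min_le_right _ _
    rw [le_div_iff₀ (by positivity)] at this
    nlinarith
  -- A small linear admixture gives every increment a positive lower bound, which mollification
  -- preserves as a positive derivative.
  set f : ℝ → ℝ := fun x => (1 - k) * σ x + k * (c / p * x) with hf
  have hfcont : Continuous f :=
    (continuous_const.mul hσ).add (continuous_const.mul (continuous_const.mul continuous_id))
  have hfper : ∀ x, f (x + p) = f x + c := fun x => by
    simp only [hf, hper]; field_simp; ring
  obtain ⟨g, hgs, hgf, hginc⟩ := exists_smooth_approx hfcont hp hfper (half_pos hδ)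
  have hslope : 0 < k * (c / p) := by positivity
  refine ⟨g, hgs, fun x => ?_, fun x => ?_, fun x => ?_⟩
  · have hgm : Monotone fun x => g x - k * (c / p) * x := by
      intro x y hxy
      have h1 := hginc (x - y) (k * (c / p) * (x - y)) (fun z => by
        have h2 : σ (z + (x - y)) ≤ σ z := hmono (by linarith)
        simp only [hf]
        nlinarith [mul_le_mul_of_nonneg_left h2 (by linarith : 0 ≤ 1 - k)]) y
      rw [add_sub_cancel] at h1
      simp only
      linarith
    have hd : HasDerivAt (fun x => g x - k * (c / p) * x) (deriv g x - k * (c / p)) x := by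
      have := ((hgs.differentiable (by simp) x).hasDerivAt).sub
        ((hasDerivAt_id x).const_mul (k * (c / p)))
      rw [mul_one] at this
      exact this
    have := hgm.deriv_nonneg (x := x)
    rw [hd.deriv] at this
    linarith
  · refine le_antisymm (hginc p c (fun y => (hfper y).le) x) ?_
    have h1 := hginc (-p) (-c) (fun y => by
      have := hfper (y + -p); rw [neg_add_cancel_right] at this; linarith) (x + p)
    rw [add_neg_cancel_right] at h1
    linarith
  · have h1 : |f x - σ x| ≤ k * B := by
      have : f x - σ x = k * (c / p * x - σ x) := by simp only [hf]; ring
      rw [this, abs_mul, abs_of_pos hk0]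
      exact mul_le_mul_of_nonneg_left (hB x) hk0.le
    have h2 := abs_sub_le (g x) (f x) (σ x)
    linarith [hgf x]

/-- If unit vectors spread in all directions, a small change of weights makes their mean vanish. -/
lemma exists_weight {T : ℝ → Plane} (hT : Continuous T) {L c : ℝ} (hc : 0 < c)
    (hsq : ∀ a : Plane, c * ‖a‖ ^ 2 ≤ ∫ s in (0 : ℝ)..L, (inner ℝ a (T s) : ℝ) ^ 2) :
    ∃ a : Plane, ‖a‖ ≤ ‖∫ s in (0 : ℝ)..L, T s‖ / c ∧
      ∫ s in (0 : ℝ)..L, (1 + inner ℝ a (T s) : ℝ) • T s = 0 := by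
  have hi : ∀ a : Plane, IntervalIntegrable (fun s => (inner ℝ a (T s) : ℝ) • T s) volume 0 L :=
    fun a => by
      have h : Continuous fun s => (inner ℝ a (T s) : ℝ) := continuous_const.inner hT
      exact (h.smul hT).intervalIntegrable _ _
  -- `M` is `∫ T ⊗ T`, positive definite by `hsq`; the required `a` solves `M a = -∫ T`.
  let M : Plane →ₗ[ℝ] Plane :=
    { toFun := fun a => ∫ s in (0 : ℝ)..L, (inner ℝ a (T s) : ℝ) • T s
      map_add' := fun a b => by
        rw [← intervalIntegral.integral_add (hi a) (hi b)]
        simp only [inner_add_left, add_smul]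
      map_smul' := fun r a => by
        rw [RingHom.id_apply, ← intervalIntegral.integral_smul]
        simp only [real_inner_smul_left, mul_smul] }
  have hMdef : ∀ a, M a = ∫ s in (0 : ℝ)..L, (inner ℝ a (T s) : ℝ) • T s := fun a => rfl
  have hM : ∀ a, c * ‖a‖ ^ 2 ≤ inner ℝ a (M a) := fun a => by
    refine (hsq a).trans_eq ?_
    have := (innerSL ℝ a).intervalIntegral_comp_comm (hi a)
    rw [innerSL_apply_apply] at this
    rw [hMdef, ← this]
    refine intervalIntegral.integral_congr fun s _ => ?_
    simp only [innerSL_apply_apply, real_inner_smul_right]; ring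
  have hinj : Function.Injective M := by
    rw [injective_iff_map_eq_zero]
    intro a ha
    have := hM a
    rw [ha, inner_zero_right] at this
    have h1 : ‖a‖ ^ 2 ≤ 0 := by
      by_contra h; push Not at h; nlinarith
    exact norm_eq_zero.1 (pow_eq_zero_iff two_ne_zero |>.1 (le_antisymm h1 (sq_nonneg _)))
  obtain ⟨a, ha⟩ := LinearMap.surjective_of_injective hinj (-∫ s in (0 : ℝ)..L, T s)
  refine ⟨a, ?_, ?_⟩
  · have h1 := (hM a).trans (real_inner_le_norm _ _)
    rw [ha, norm_neg] at h1
    rw [le_div_iff₀ hc]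
    rcases (norm_nonneg a).eq_or_lt with h0 | h0
    · rw [← h0, zero_mul]; exact norm_nonneg _
    · nlinarith
  · simp only [add_smul, one_smul]
    rw [intervalIntegral.integral_add (hT.intervalIntegrable _ _) (hi a), ← hMdef, ha,
      add_neg_cancel]

/-- The closed curves obtained from `u` satisfying the requirements for an anisotropy `φ`. -/
structure IsAdmissible (φ : Plane → ℝ) (C : ℝ) (u : ℝ → Plane) : Prop where
  periodic : Function.Periodic u (2 * Real.pi)
  smooth : ContDiff ℝ ∞ u
  regular : ∀ x, deriv u x ≠ 0
  phiRegular : IsPhiRegular φ u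
  curvature : ∃ κ : ℝ → ℝ, IsAnisotropicCurvature φ u κ ∧ ∀ᵐ s : ℝ, |κ s| ≤ C

namespace IsCahnHoffmanCurve

variable {φ : Plane → ℝ} {γ N : ℝ → Plane} {L C : ℝ} (hc : IsCahnHoffmanCurve φ γ N L C)
include hc

lemma integral_tangent : ∫ s in (0 : ℝ)..L, tangent γ s = 0 := by
  have h1 := hc.lipschitz.integral_deriv_eq_sub 0 L
  have h2 : γ L = γ 0 := by simpa using hc.periodic 0
  rw [h2, sub_self] at h1
  exact h1

/-- A weighted unit field close to the tangent in the mean is the tangent field of a closed curve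
close to the given one. -/
lemma exists_closed_curve {c₀ : ℝ} (hc₀ : 0 < c₀)
    (hsq : ∀ a : Plane, c₀ * ‖a‖ ^ 2 ≤ ∫ s in (0 : ℝ)..L, (inner ℝ a (tangent γ s) : ℝ) ^ 2)
    {T : ℝ → Plane} (hT : ContDiff ℝ ∞ T) (hT1 : ∀ s, ‖T s‖ = 1) (hTper : Function.Periodic T L)
    {e : ℝ} (he : e ≤ c₀ / 4) (hTe : ∫ s in (0 : ℝ)..L, ‖T s - tangent γ s‖ ≤ e) :
    ∃ (V : ℝ → Plane) (ρ : ℝ → ℝ), ContDiff ℝ ∞ V ∧ Function.Periodic V L ∧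
      (∀ s, HasDerivAt V (ρ s • T s) s) ∧ (∀ s, 1 - 2 * e / c₀ ≤ ρ s) ∧
      ∀ s, ‖V s - γ s‖ ≤ e + 2 * e / c₀ * L := by
  have hL := hc.pos
  have hTi : ∀ a b, IntervalIntegrable T volume a b := fun a b =>
    hT.continuous.intervalIntegrable a b
  have hτi : ∀ a b, IntervalIntegrable (tangent γ) volume a b :=
    hc.lipschitz.intervalIntegrable_deriv
  have hdi : ∀ a b, IntervalIntegrable (fun s => ‖T s - tangent γ s‖) volume a b := fun a b =>
    ((hTi a b).sub (hτi a b)).norm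
  -- Replacing `τ` by `T` changes the quadratic form by at most `2 ‖a‖² e`, so `e ≤ c₀ / 4` leaves
  -- half of the coercivity.
  have hTsq : ∀ a : Plane, c₀ / 2 * ‖a‖ ^ 2 ≤ ∫ s in (0 : ℝ)..L, (inner ℝ a (T s) : ℝ) ^ 2 := by
    intro a
    have hi2 : IntervalIntegrable (fun s => (inner ℝ a (T s) : ℝ) ^ 2) volume 0 L :=
      ((continuous_const.inner hT.continuous).pow 2).intervalIntegrable _ _
    have h1 : ∫ s in (0 : ℝ)..L, (inner ℝ a (tangent γ s) : ℝ) ^ 2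
        ≤ ∫ s in (0 : ℝ)..L, ((inner ℝ a (T s) : ℝ) ^ 2
          + 2 * ‖a‖ ^ 2 * ‖T s - tangent γ s‖) := by
      refine intervalIntegral.integral_mono_on hL.le (hc.intervalIntegrable_inner_sq a 0 L)
        (hi2.add ((hdi 0 L).const_mul _)) fun s _ => ?_
      have e1 : (inner ℝ a (tangent γ s) : ℝ) = inner ℝ a (T s) - inner ℝ a (T s - tangent γ s) := by
        rw [inner_sub_right]; ring
      have b1 := abs_le.1 (hc.abs_inner_le a s)
      have b2 : |(inner ℝ a (T s) : ℝ)| ≤ ‖a‖ := by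
        have := abs_real_inner_le_norm a (T s); rwa [hT1, mul_one] at this
      have b2' := abs_le.1 b2
      have b3 := abs_real_inner_le_norm a (T s - tangent γ s)
      set x : ℝ := inner ℝ a (T s)
      set y : ℝ := inner ℝ a (tangent γ s)
      set z : ℝ := inner ℝ a (T s - tangent γ s)
      have e2 : y ^ 2 = x ^ 2 + -(x + y) * z := by rw [e1]; ring
      have e3 : -(x + y) * z ≤ |x + y| * |z| := by
        rw [← abs_mul, neg_mul]; exact neg_le_abs _
      have e4 : |x + y| ≤ 2 * ‖a‖ := abs_le.2 ⟨by linarith, by linarith⟩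
      have e5 : |x + y| * |z| ≤ 2 * ‖a‖ * (‖a‖ * ‖T s - tangent γ s‖) := by gcongr
      linarith
    rw [intervalIntegral.integral_add hi2 ((hdi 0 L).const_mul _),
      intervalIntegral.integral_const_mul] at h1
    have h2 := hsq a
    have h3 : 2 * ‖a‖ ^ 2 * ∫ s in (0 : ℝ)..L, ‖T s - tangent γ s‖ ≤ 2 * ‖a‖ ^ 2 * (c₀ / 4) := by
      gcongr; exact hTe.trans he
    linarith
  obtain ⟨a, ha, ha0⟩ := exists_weight hT.continuous (half_pos hc₀) hTsq
  have hpart : ∀ s ∈ Icc 0 L, ‖∫ t in (0 : ℝ)..s, (T t - tangent γ t)‖ ≤ e := by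
    intro s hs
    refine (intervalIntegral.norm_integral_le_integral_norm hs.1).trans (le_trans ?_ hTe)
    exact intervalIntegral.integral_mono_interval le_rfl hs.1 hs.2
      (Eventually.of_forall fun t => norm_nonneg _) (hdi 0 L)
  have hmean : ‖∫ s in (0 : ℝ)..L, T s‖ ≤ e := by
    have h1 := hpart L ⟨hL.le, le_rfl⟩
    rwa [intervalIntegral.integral_sub (hTi 0 L) (hτi 0 L), hc.integral_tangent, sub_zero] at h1
  have hae : ‖a‖ ≤ 2 * e / c₀ := by
    refine ha.trans ?_
    rw [div_le_div_iff₀ (half_pos hc₀) hc₀]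
    nlinarith
  set ρ : ℝ → ℝ := fun s => 1 + inner ℝ a (T s) with hρ
  have hρs : ContDiff ℝ ∞ ρ := contDiff_const.add (contDiff_const.inner ℝ hT)
  have hW : ContDiff ℝ ∞ fun s => ρ s • T s := hρs.smul hT
  have hWi : ∀ a b, IntervalIntegrable (fun s => ρ s • T s) volume a b := fun a b =>
    hW.continuous.intervalIntegrable a b
  set V : ℝ → Plane := fun s => γ 0 + ∫ t in (0 : ℝ)..s, ρ t • T t with hV
  have hVd : ∀ s, HasDerivAt V (ρ s • T s) s := fun s =>
    (intervalIntegral.integral_hasDerivAt_right (hWi _ _)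
      hW.continuous.stronglyMeasurable.stronglyMeasurableAtFilter hW.continuous.continuousAt).const_add _
  have hVs : ContDiff ℝ ∞ V := by
    rw [contDiff_infty_iff_deriv]
    refine ⟨fun s => (hVd s).differentiableAt, ?_⟩
    rwa [show deriv V = fun s => ρ s • T s from funext fun s => (hVd s).deriv]
  have hWper : Function.Periodic (fun s => ρ s • T s) L := fun s => by
    simp only [hρ, hTper s]
  have hVper : Function.Periodic V L := fun s => by
    simp only [hV]
    rw [← intervalIntegral.integral_add_adjacent_intervals (hWi 0 s) (hWi s (s + L)),
      hWper.intervalIntegral_add_eq s 0, zero_add, ha0, add_zero]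
  have hinner : ∀ s, |(inner ℝ a (T s) : ℝ)| ≤ 2 * e / c₀ := fun s => by
    have := abs_real_inner_le_norm a (T s)
    rw [hT1, mul_one] at this
    exact this.trans hae
  refine ⟨V, ρ, hVs, hVper, hVd, fun s => ?_, ?_⟩
  · simp only [hρ]; linarith [(abs_le.1 (hinner s)).1]
  · have hI : ∀ s ∈ Icc 0 L, ‖V s - γ s‖ ≤ e + 2 * e / c₀ * L := by
      intro s hs
      have hai : IntervalIntegrable (fun t => (inner ℝ a (T t) : ℝ) • T t) volume 0 s := by
        have h : Continuous fun s => (inner ℝ a (T s) : ℝ) := continuous_const.inner hT.continuous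
        exact (h.smul hT.continuous).intervalIntegrable _ _
      have e1 : V s - γ s = (∫ t in (0 : ℝ)..s, (T t - tangent γ t))
          + ∫ t in (0 : ℝ)..s, (inner ℝ a (T t) : ℝ) • T t := by
        have h1 := hc.lipschitz.integral_deriv_eq_sub 0 s
        rw [intervalIntegral.integral_sub (hTi 0 s) (hτi 0 s)]
        simp only [hV, hρ, add_smul, one_smul]
        rw [intervalIntegral.integral_add (hTi 0 s) hai]
        rw [show (∫ t in (0 : ℝ)..s, tangent γ t) = γ s - γ 0 from h1]
        abel
      have h2 : ‖∫ t in (0 : ℝ)..s, (inner ℝ a (T t) : ℝ) • T t‖ ≤ 2 * e / c₀ * |s - 0| :=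
        intervalIntegral.norm_integral_le_of_norm_le_const fun t _ => by
          rw [norm_smul, hT1, mul_one]; exact hinner t
      rw [sub_zero, abs_of_nonneg hs.1] at h2
      have h3 : 2 * e / c₀ * s ≤ 2 * e / c₀ * L :=
        mul_le_mul_of_nonneg_left hs.2 ((norm_nonneg _).trans hae)
      rw [e1]
      refine (norm_add_le _ _).trans ?_
      linarith [hpart s hs]
    intro s
    obtain ⟨k, hk, -⟩ := existsUnique_sub_zsmul_mem_Ico hL s 0
    rw [zero_add] at hk
    have h1 := hI _ (Ico_subset_Icc_self hk)
    rwa [hVper.sub_zsmul_eq, hc.periodic.sub_zsmul_eq] at h1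

/-- Approximation by admissible curves for anisotropies close to the given one. -/
lemma exists_admissible (hφ : IsAnisotropy φ) {C' : ℝ} (hC' : C < C') {u : ℝ → Plane} {σ : ℝ → ℝ}
    (hσ : Continuous σ) (hσm : Monotone σ) (hσper : ∀ x, σ (x + 2 * Real.pi) = σ x + L)
    (hu : ∀ x, u x = γ (σ x)) {η : ℝ} (hη : 0 < η) :
    ∃ δ, 0 < δ ∧ ∀ φ' : Plane → ℝ, IsAnisotropy φ' → ContDiffOn ℝ ∞ φ' {0}ᶜ → IsElliptic φ' →
      (∀ x, φ x ≤ φ' x) → (∀ x, φ' x ≤ (1 + δ) * φ x) →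
      ∃ v, IsAdmissible φ' C' v ∧ ∀ x, ‖v x - u x‖ ≤ η := by
  have hL := hc.pos
  have hC0 := hc.nonneg
  have hC'0 : 0 < C' := hC0.trans_lt hC'
  obtain ⟨c₀, hc₀, hsq⟩ := hc.exists_integral_inner_sq_ge hφ
  -- Half of the slack goes to the speed of `l`, the other half to the weight: `|l'| ≤ C₁` and `ρ ≥
  -- 1 - μ` give curvature at most `C₁ / (1 - μ) ≤ C'`.
  set C₁ : ℝ := (C + C') / 2 with hC₁
  set μ : ℝ := min (1 / 2) (min ((C' - C₁) / C') (η / (4 * L))) with hμ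
  have hC₁' : C₁ < C' := by linarith
  have hμ0 : 0 < μ := lt_min (by norm_num) (lt_min (div_pos (by linarith) hC'0) (by positivity))
  have hμ1 : μ ≤ 1 / 2 := min_le_left _ _
  have hμ2 : C₁ ≤ C' * (1 - μ) := by
    have : μ ≤ (C' - C₁) / C' := (min_le_right _ _).trans (min_le_left _ _)
    rw [le_div_iff₀ hC'0] at this
    linarith
  have hμ3 : μ * L ≤ η / 4 := by
    have : μ ≤ η / (4 * L) := (min_le_right _ _).trans (min_le_right _ _)
    rw [le_div_iff₀ (by positivity)] at this
    linarith
  set e : ℝ := min (c₀ / 4) (min (c₀ * μ / 2) (η / 4)) with he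
  have he0 : 0 < e := by positivity
  have he1 : e ≤ c₀ / 4 := min_le_left _ _
  have he2 : 2 * e / c₀ ≤ μ := by
    have : e ≤ c₀ * μ / 2 := (min_le_right _ _).trans (min_le_left _ _)
    rw [div_le_iff₀ hc₀]; linarith
  have he3 : e ≤ η / 4 := (min_le_right _ _).trans (min_le_right _ _)
  obtain ⟨δ, hδ, hmain⟩ := hc.exists_angle hφ (by linarith : C < C₁) he0
  refine ⟨δ, hδ, fun φ' hφ' hs' hell' hle hge => ?_⟩
  obtain ⟨p, hp⟩ := hφ'.exists_unitSphereParam hs'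
  obtain ⟨l, c, hls, hld, hlper, hpc, hint⟩ := hmain φ' hφ' hle hge p hp
  obtain ⟨V, ρ, hVs, hVper, hVd, hρ, hVγ⟩ := hc.exists_closed_curve hc₀ hsq
    (T := fun s => -deriv p (l s)) (hp.contDiff_deriv.comp hls).neg
    (fun s => by rw [norm_neg, hp.speed]) (fun s => by
      simp only [hlper, hpc.deriv_periodic (l s)]) he1 hint
  obtain ⟨g, hgs, hgd, hgper, hgσ⟩ := exists_smooth_reparam hσ hσm Real.two_pi_pos hL hσper
    (by positivity : 0 < η / 4)
  have hgder : ∀ x, HasDerivAt g (deriv g x) x := fun x =>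
    (hgs.differentiable (by simp) x).hasDerivAt
  have hvs : ContDiff ℝ ∞ fun x => V (g x) := hVs.comp hgs
  have hvper : Function.Periodic (fun x => V (g x)) (2 * Real.pi) := fun x => by
    simp only [hgper, hVper (g x)]
  have hρpos : ∀ s, 0 < ρ s := fun s => by linarith [hρ s]
  have hadm := hp.isPhiRegular_and_curvature_le hφ' hell' (u := fun x => V (g x))
    (l := fun x => l (g x)) (w := fun x => deriv g x * ρ (g x)) (C := C') hvs (hls.comp hgs) hvper
    (fun x => by simp only [hgper, hlper, hpc (l (g x))])
    (fun x => mul_pos (hgd x) (hρpos _)) (fun x => by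
      have h1 : HasDerivAt (fun x => V (g x)) (deriv g x • (ρ (g x) • -deriv p (l (g x)))) x :=
        (hVd (g x)).scomp x (hgder x)
      rw [h1.deriv, smul_neg, smul_neg, smul_smul]) (fun x => by
      have h1 : HasDerivAt (fun x => l (g x)) (deriv l (g x) * deriv g x) x :=
        ((hls.differentiable (by simp) (g x)).hasDerivAt).comp x (hgder x)
      rw [h1.deriv, abs_mul, abs_of_pos (hgd x)]
      have h2 : C₁ ≤ C' * ρ (g x) := by
        refine hμ2.trans (mul_le_mul_of_nonneg_left ?_ hC'0.le)
        linarith [hρ (g x)]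
      calc |deriv l (g x)| * deriv g x ≤ C' * ρ (g x) * deriv g x :=
            mul_le_mul_of_nonneg_right ((hld _).trans h2) (hgd x).le
        _ = C' * (deriv g x * ρ (g x)) := by ring)
  refine ⟨fun x => V (g x), ⟨hvper, hvs, hadm.1, hadm.2.1, hadm.2.2⟩, fun x => ?_⟩
  have h1 := hVγ (g x)
  have h2 : ‖γ (g x) - γ (σ x)‖ ≤ η / 4 := by
    have := hc.lipschitz.dist_le_mul (g x) (σ x)
    rw [NNReal.coe_one, one_mul, dist_eq_norm, Real.dist_eq] at this
    exact this.trans (hgσ x)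
  -- The error consists of `e`, `μ L` and the change of parameter, each at most `η / 4`.
  have h3 : 2 * e / c₀ * L ≤ μ * L := by gcongr
  rw [hu]
  have h4 := norm_sub_le_norm_sub_add_norm_sub (V (g x)) (γ (g x)) (γ (σ x))
  linarith

end IsCahnHoffmanCurve

/-! ### Selection of one curve for every parameter. -/

/-- Uniform convergence on the unit circle gives comparability of anisotropies. -/
lemma eventually_le_mul {φ : Plane → ℝ} (hφ : IsAnisotropy φ) {φε : ℝ → Plane → ℝ}
    (haniso : ∀ ε > 0, IsAnisotropy (φε ε))
    (hconv : TendstoUniformlyOn φε φ (𝓝[>] 0) (Metric.sphere 0 1)) {δ : ℝ} (hδ : 0 < δ) :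
    ∀ᶠ ε in 𝓝[>] (0 : ℝ), ∀ x, φε ε x ≤ (1 + δ) * φ x := by
  obtain ⟨r, hr, hlow⟩ := hφ.exists_lower
  filter_upwards [Metric.tendstoUniformlyOn_iff.1 hconv (δ * r) (by positivity),
    self_mem_nhdsWithin] with ε hε hpos x
  by_cases hx : x = 0
  · rw [hx, (haniso ε hpos).map_zero, hφ.map_zero, mul_zero]
  have hn : 0 < ‖x‖ := norm_pos_iff.2 hx
  have h1 := hε (‖x‖⁻¹ • x) (by simp [norm_smul, hn.ne'])
  rw [Real.dist_eq, (haniso ε hpos).smul, hφ.smul, abs_of_pos (inv_pos.2 hn), ← mul_sub, abs_mul,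
    abs_of_pos (inv_pos.2 hn), inv_mul_lt_iff₀ hn] at h1
  have h2 := neg_le_of_abs_le h1.le
  have h3 := hlow x
  nlinarith

/-- A curve attaining the finest tolerance available below `M` serves all coarser ones too. One
choice for each `ε` is thus enough, although the approximation comes without a rate. -/
lemma exists_near_optimal {P : (ℝ → Plane) → Prop} (hP : ∃ v, P v) (u : ℝ → Plane) (M : ℕ) :
    ∃ v, P v ∧ ∀ n < M, (∃ w, P w ∧ ∀ x, ‖w x - u x‖ ≤ 1 / ((n : ℝ) + 1)) →
      ∀ x, ‖v x - u x‖ ≤ 1 / ((n : ℝ) + 1) := by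
  induction M with
  | zero => obtain ⟨v, hv⟩ := hP; exact ⟨v, hv, fun n hn => absurd hn (Nat.not_lt_zero n)⟩
  | succ M ih =>
    by_cases h : ∃ w, P w ∧ ∀ x, ‖w x - u x‖ ≤ 1 / ((M : ℝ) + 1)
    · obtain ⟨w, hw, hwu⟩ := h
      refine ⟨w, hw, fun n hn _ x => (hwu x).trans ?_⟩
      have : (n : ℝ) ≤ M := by exact_mod_cast Nat.lt_succ_iff.1 hn
      gcongr
    · obtain ⟨v, hv, hvn⟩ := ih
      refine ⟨v, hv, fun n hn hw => ?_⟩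
      rcases Nat.lt_succ_iff_lt_or_eq.1 hn with hn | rfl
      · exact hvn n hn hw
      · exact absurd hw h

theorem mainTheorem2
    (φ : Plane → ℝ) (hφ : IsAnisotropy φ)
    (u : ℝ → Plane) (hu : IsPhiRegular φ u)
    (κ : ℝ → ℝ) (hκ : IsAnisotropicCurvature φ u κ)
    (C : ℝ) (hC : ∀ᵐ s : ℝ, |κ s| ≤ C)
    (φε : ℝ → Plane → ℝ)
    (haniso : ∀ ε > 0, IsAnisotropy (φε ε))
    (hsmooth : ∀ ε > 0, ContDiffOn ℝ ∞ (φε ε) {0}ᶜ)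
    (hell : ∀ ε > 0, IsElliptic (φε ε))
    (hle : ∀ ε > 0, ∀ x, φ x ≤ φε ε x)
    (hconv : ∀ K : Set Plane, IsCompact K → TendstoUniformlyOn φε φ (𝓝[>] 0) K)
    (C' : ℝ) (hC' : C < C') :
    ∃ uε : ℝ → ℝ → Plane,
      (∀ ε > 0,
        Function.Periodic (uε ε) (2 * Real.pi) ∧
        ContDiff ℝ ∞ (uε ε) ∧
        (∀ x, deriv (uε ε) x ≠ 0) ∧
        IsPhiRegular (φε ε) (uε ε) ∧
        ∃ κε : ℝ → ℝ, IsAnisotropicCurvature (φε ε) (uε ε) κε ∧ ∀ᵐ s : ℝ, |κε s| ≤ C') ∧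
      TendstoUniformly uε u (𝓝[>] 0) := by
  obtain ⟨γ, L, N, hγ, hN, hκN⟩ := hκ
  have hc : IsCahnHoffmanCurve φ γ N L C := hN.1.isCahnHoffmanCurve hφ hγ (by
    filter_upwards [hκN, hC] with s h1 h2
    rwa [h1, abs_neg] at h2)
  have hC'0 : 0 < C' := hc.nonneg.trans_lt hC'
  obtain ⟨σ, hσ, hσm, -, hσper, huσ⟩ := hγ.reparam
  -- The cutoff `⌈1 / ε⌉₊` tends to infinity as `ε → 0⁺`, so every tolerance is eventually tested.
  -- The dilated unit sphere shows that admissible curves exist for all `ε > 0`, even where none is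
  -- close to `u`.
  have hchoice : ∀ ε : ℝ, ∃ v : ℝ → Plane, 0 < ε → IsAdmissible (φε ε) C' v ∧
      ∀ n < ⌈1 / ε⌉₊, (∃ w, IsAdmissible (φε ε) C' w ∧ ∀ x, ‖w x - u x‖ ≤ 1 / ((n : ℝ) + 1)) →
        ∀ x, ‖v x - u x‖ ≤ 1 / ((n : ℝ) + 1) := by
    intro ε
    by_cases hε : 0 < ε
    · obtain ⟨w, h1, h2, h3, h4, h5⟩ := (haniso ε hε).exists_curve_curvature_le (hsmooth ε hε)
        (hell ε hε) hC'0
      obtain ⟨v, hv⟩ := exists_near_optimal ⟨w, (⟨h1, h2, h3, h4, h5⟩ :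
        IsAdmissible (φε ε) C' w)⟩ u ⌈1 / ε⌉₊
      exact ⟨v, fun _ => hv⟩
    · exact ⟨u, fun h => absurd h hε⟩
  choose uε huε using hchoice
  refine ⟨uε, fun ε hε => ?_, ?_⟩
  · obtain ⟨h1, h2, h3, h4, h5⟩ := (huε ε hε).1
    exact ⟨h1, h2, h3, h4, h5⟩
  · rw [Metric.tendstoUniformly_iff]
    intro η hη
    obtain ⟨n, hn⟩ := exists_nat_one_div_lt hη
    obtain ⟨δ, hδ, hadm⟩ := hc.exists_admissible hφ hC' hσ hσm.monotone hσper huσ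
      (by positivity : (0 : ℝ) < 1 / ((n : ℝ) + 1))
    have hsmall : ∀ᶠ ε in 𝓝[>] (0 : ℝ), ε < 1 / ((n : ℝ) + 1) :=
      mem_nhdsWithin_of_mem_nhds (Iio_mem_nhds (by positivity))
    filter_upwards [eventually_le_mul hφ haniso (hconv _ (isCompact_sphere 0 1)) hδ, hsmall,
      self_mem_nhdsWithin] with ε hge hεn hε x
    have hε' : 0 < ε := hε
    have hlt : n < ⌈1 / ε⌉₊ := by
      rw [Nat.lt_ceil, lt_div_iff₀ hε']
      rw [lt_div_iff₀ (by positivity)] at hεn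
      linarith
    rw [dist_comm, dist_eq_norm]
    exact ((huε ε hε).2 n hlt (hadm _ (haniso ε hε) (hsmooth ε hε) (hell ε hε) (hle ε hε) hge)
      x).trans_lt hn
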